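/- Let $n\ge 0$ be an integer, $\mathbb T^n=(\mathbb R/\mathbb Z)^n$ with normalized Haar measure, and equip $\mathbb Z^n\times\mathbb T^n$ with the product of counting measure and Haar measure. Let $\mathcal S'$ denote the space of tempered distributions, i.e. of continuous linear functionals on the Schwartz space $\mathcal S$, both on $\mathbb Z^n$ (rapidly decreasing functions) and on $\mathbb Z^n\times\mathbb T^n$ (functions smooth in the torus variable and rapidly decreasing, with all torus derivatives, in the lattice variable). For $m\in\mathbb Z^n$, $w\in\mathbb T^n$ put $M_wT_mg(k)=e^{2\pi i w\cdot k}g(k-m)$ and $V_gf(m,w)=\langle f,M_wT_mg\rangle=\sum_{k\in\mathbb Z^n}f(k)\overline{g(k-m)}e^{-2\pi i w\cdot k}$. Let $\Phi:[0,\infty]\to[0,\infty]$ be a Young function (convex, $\Phi(0)=0$, $\lim_{t\to\infty}\Phi(t)=\Phi(\infty)=\infty$) with $$\Phi(x)=-x^2\log x\quad\text{for } 0\le x\le e^{-3/2}\qquad(\Phi(0)=0).$$ Fix a non-zero window $\gamma\in\mathcal S(\mathbb Z^n)$, and let $M^\Phi(\mathbb Z^n)$ be the set of $f\in\mathcal S'(\mathbb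 Z^n)$ such that $V_\gamma f$ lies in the Orlicz space $L^\Phi(\mathbb Z^n\times\mathbb T^n)$, i.e. $\inf\{b>0:\sum_{m}\int_{\mathbb T^n}\Phi(|V_\gamma f(m,w)|/b)\,dw\le 1\}<\infty$. Fix a non-zero window $G\in\mathcal S(\mathbb Z^n\times\mathbb T^n)$, and for $1\le p\le 2$ let $M^p(\mathbb Z^n\times\mathbb T^n)$ be the set of $F\in\mathcal S'(\mathbb Z^n\times\mathbb T^n)$ whose short-time Fourier transform $$V_GF(m,\omega,\xi,k)=\sum_{j\in\mathbb Z^n}\int_{\mathbb T^n}e^{-2\pi i j\cdot\xi}e^{-2\pi i\eta\cdot k}F(j,\eta)\overline{G(j-m,\eta-\omega)}\,d\eta$$ (understood as a distributional pairing) lies in $L^p\big((\mathbb Z^n\times\mathbb T^n)\times(\mathbb T^n\times\mathbb Z^n)\big)$. Let $1\le p\le 2$, $\varsigma\in M^p(\mathbb Z^n\times\mathbb T^n)$ and $g_1,g_2\in M^\Phi(\mathbb Z^n)$. Then $\varsigma$ is given by a function on $\mathbb Z^n\times\mathbb T^n$, and the localization operator $$\mathfrak L^{g_1,g_2}_{\varsigma}f(k)=\sum_{m\in\mathbb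 Z^n}\int_{\mathbb T^n}\varsigma(m,w)\,V_{g_1}f(m,w)\,M_wT_mg_2(k)\,dw,\qquad f\in\ell^2(\mathbb Z^n),\ k\in\mathbb Z^n,$$ is well defined (the series defining $V_{g_1}f$ and the sum-integral converge absolutely) and is a bounded and compact linear operator $\ell^2(\mathbb Z^n)\to\ell^2(\mathbb Z^n)$. -/

import Mathlib

open MeasureTheory Topology Filter
open scoped ENNReal NNReal ContDiff ComplexConjugate

noncomputable section

namespace DiscreteTF

/-! ### The groups `ℤⁿ`, `𝕋ⁿ`, `ℤⁿ × 𝕋ⁿ` and their Haar measures -/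

/-- The lattice `ℤⁿ`. -/
abbrev Lattice (n : ℕ) : Type := Fin n → ℤ

/-- The torus `𝕋ⁿ = (ℝ/ℤ)ⁿ`. -/
abbrev Torus (n : ℕ) : Type := UnitAddTorus (Fin n)

/-- The phase space `ℤⁿ × 𝕋ⁿ`. -/
abbrev Phase (n : ℕ) : Type := Lattice n × Torus n

/-- Normalized Haar measure on `𝕋ⁿ`. -/
def torusMeasure (n : ℕ) : Measure (Torus n) :=
  Measure.pi fun _ => AddCircle.haarAddCircle

/-- Haar measure on `ℤⁿ × 𝕋ⁿ`: counting measure times normalized Haar measure. -/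
def phaseMeasure (n : ℕ) : Measure (Phase n) :=
  (Measure.count : Measure (Lattice n)).prod (torusMeasure n)

/-- Haar measure on `(ℤⁿ × 𝕋ⁿ) × (𝕋ⁿ × ℤⁿ)`, the second factor being the dual group of the first. -/
def phaseDualMeasure (n : ℕ) : Measure (Phase n × (Torus n × Lattice n)) :=
  (phaseMeasure n).prod ((torusMeasure n).prod Measure.count)

/-- The character `e^{2πi k·w}` for `k ∈ ℤⁿ` and `w ∈ 𝕋ⁿ`. -/
def character {n : ℕ} (k : Lattice n) (w : Torus n) : ℂ := UnitAddTorus.mFourier k w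

lemma norm_character {n : ℕ} (k : Lattice n) (w : Torus n) : ‖character k w‖ = 1 := by
  simp only [character, UnitAddTorus.mFourier, ContinuousMap.coe_mk, norm_prod, fourier_apply,
    Circle.norm_coe, Finset.prod_const_one]

/-! ### The Schwartz space of `ℤⁿ`, tempered distributions and the short-time Fourier transform -/

/-- Rapidly decreasing functions on `ℤⁿ`, as a subspace of all functions. -/
def schwartzLatticeSubmodule (n : ℕ) : Submodule ℂ (Lattice n → ℂ) where
  carrier := {g | ∀ M : ℕ, ∃ C : ℝ, ∀ k, (1 + ‖k‖) ^ M * ‖g k‖ ≤ C}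
  zero_mem' := fun _ => ⟨0, by simp⟩
  add_mem' := by
    intro f g hf hg M
    obtain ⟨C, hC⟩ := hf M
    obtain ⟨D, hD⟩ := hg M
    refine ⟨C + D, fun k => ?_⟩
    calc (1 + ‖k‖) ^ M * ‖f k + g k‖ ≤ (1 + ‖k‖) ^ M * (‖f k‖ + ‖g k‖) := by
          gcongr; exact norm_add_le _ _
      _ ≤ C + D := by rw [mul_add]; exact add_le_add (hC k) (hD k)
  smul_mem' := by
    intro c f hf M
    obtain ⟨C, hC⟩ := hf M
    refine ⟨‖c‖ * C, fun k => ?_⟩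
    calc (1 + ‖k‖) ^ M * ‖c • f k‖ = ‖c‖ * ((1 + ‖k‖) ^ M * ‖f k‖) := by rw [norm_smul]; ring
      _ ≤ ‖c‖ * C := by gcongr; exact hC k

/-- The Schwartz space `𝒮(ℤⁿ)`. -/
def SchwartzLattice (n : ℕ) : Type := schwartzLatticeSubmodule n

namespace SchwartzLattice

variable {n : ℕ}

instance : AddCommGroup (SchwartzLattice n) :=
  inferInstanceAs (AddCommGroup (schwartzLatticeSubmodule n))

instance : Module ℂ (SchwartzLattice n) :=
  inferInstanceAs (Module ℂ (schwartzLatticeSubmodule n))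

instance : CoeFun (SchwartzLattice n) (fun _ => Lattice n → ℂ) := ⟨fun g => g.1⟩

lemma add_apply (f g : SchwartzLattice n) (k : Lattice n) : (f + g) k = f k + g k := rfl

lemma smul_apply (c : ℂ) (g : SchwartzLattice n) (k : Lattice n) : (c • g) k = c * g k := rfl

lemma bddAbove (g : SchwartzLattice n) (j : ℕ) :
    BddAbove (Set.range fun k : Lattice n => (1 + ‖k‖) ^ j * ‖g k‖) := by
  obtain ⟨C, hC⟩ := g.2 j
  exact ⟨C, by rintro _ ⟨k, rfl⟩; exact hC k⟩

/-- The seminorm `p_j(g) = sup_k (1 + |k|)^j |g(k)|`. -/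
def seminorm (n j : ℕ) : Seminorm ℂ (SchwartzLattice n) :=
  Seminorm.of (fun g => ⨆ k : Lattice n, (1 + ‖k‖) ^ j * ‖g k‖)
    (by
      intro f g
      refine ciSup_le fun k => ?_
      calc (1 + ‖k‖) ^ j * ‖(f + g) k‖ ≤ (1 + ‖k‖) ^ j * (‖f k‖ + ‖g k‖) := by
            rw [add_apply]; gcongr; exact norm_add_le _ _
        _ ≤ _ := by
            rw [mul_add]
            exact add_le_add (le_ciSup (bddAbove f j) k) (le_ciSup (bddAbove g j) k))
    (by
      intro c g
      rw [Real.mul_iSup_of_nonneg (norm_nonneg c)]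
      refine congrArg _ (funext fun k => ?_)
      rw [smul_apply, norm_mul]; ring)

/-- The topology generated by the seminorms `p_j`. -/
instance : TopologicalSpace (SchwartzLattice n) :=
  SeminormFamily.moduleFilterBasis (𝕜 := ℂ) (seminorm n) |>.topology

lemma withSeminorms (n : ℕ) :
    WithSeminorms (𝕜 := ℂ) (E := SchwartzLattice n) (seminorm n) := ⟨rfl⟩

/-- Time-frequency shift `(M_w T_m g)(k) = e^{2πi w·k} g(k - m)`. -/
def timeFreqShift (m : Lattice n) (w : Torus n) (g : SchwartzLattice n) : SchwartzLattice n :=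
  ⟨fun k => character k w * g (k - m), by
    intro M
    obtain ⟨C, hC⟩ := g.2 M
    refine ⟨(1 + ‖m‖) ^ M * C, fun k => ?_⟩
    have h : (1 + ‖k‖) ≤ (1 + ‖m‖) * (1 + ‖k - m‖) := by
      have : ‖k‖ ≤ ‖k - m‖ + ‖m‖ := by simpa using norm_add_le (k - m) m
      nlinarith [mul_nonneg (norm_nonneg m) (norm_nonneg (k - m))]
    calc (1 + ‖k‖) ^ M * ‖character k w * g (k - m)‖
        ≤ ((1 + ‖m‖) * (1 + ‖k - m‖)) ^ M * ‖g (k - m)‖ := by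
          rw [norm_mul, norm_character, one_mul]; gcongr
      _ = (1 + ‖m‖) ^ M * ((1 + ‖k - m‖) ^ M * ‖g (k - m)‖) := by rw [mul_pow]; ring
      _ ≤ _ := by gcongr; exact hC _⟩

/-- Pointwise complex conjugate. -/
def conjugate (g : SchwartzLattice n) : SchwartzLattice n :=
  ⟨fun k => conj (g k), fun M => by simpa using g.2 M⟩

/-- The Kronecker delta at `k`. -/
def delta (k : Lattice n) : SchwartzLattice n :=
  ⟨fun l => if l = k then 1 else 0, fun M => by
    refine ⟨(1 + ‖k‖) ^ M, fun l => ?_⟩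
    dsimp only
    split_ifs with h
    · simp [h]
    · simp only [norm_zero, mul_zero]; positivity⟩

end SchwartzLattice

/-- Tempered distributions `𝒮'(ℤⁿ)`: continuous linear functionals on `𝒮(ℤⁿ)`. A function `f`
of at most polynomial growth corresponds to `φ ↦ ∑ₖ f(k) φ(k)`. -/
abbrev TemperedLattice (n : ℕ) : Type := SchwartzLattice n →L[ℂ] ℂ

/-- The function on `ℤⁿ` determined by a tempered distribution. -/
def TemperedLattice.toFun {n : ℕ} (u : TemperedLattice n) (k : Lattice n) : ℂ :=
  u (SchwartzLattice.delta k)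

/-- The short-time Fourier transform `V_g u (m, w) = ⟨u, M_w T_m g⟩` of a tempered distribution
on `ℤⁿ` with window `g ∈ 𝒮(ℤⁿ)`. -/
def stft {n : ℕ} (g : SchwartzLattice n) (u : TemperedLattice n) (z : Phase n) : ℂ :=
  u (SchwartzLattice.timeFreqShift z.1 z.2 g).conjugate

/-! ### Young functions, Orlicz spaces, Orlicz modulation spaces -/

/-- Young functions `Φ : [0,∞] → [0,∞]`. -/
structure IsYoungFunction (Φ : ℝ≥0∞ → ℝ≥0∞) : Prop where
  convex : ∀ x₁ x₂ y₁ y₂ : ℝ≥0, x₁ + x₂ = 1 →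
    Φ ((x₁ * y₁ + x₂ * y₂ : ℝ≥0) : ℝ≥0∞) ≤ x₁ * Φ y₁ + x₂ * Φ y₂
  map_zero : Φ 0 = 0
  map_top : Φ ⊤ = ⊤
  tendsto_top : Tendsto Φ (𝓝[<] ⊤) (𝓝 ⊤)

/-- The Luxemburg norm `inf {b > 0 : ∫ Φ(|F|/b) dμ ≤ 1}`, with value `∞` if there is no such `b`. -/
def luxemburgNorm {X : Type*} [MeasurableSpace X] (Φ : ℝ≥0∞ → ℝ≥0∞) (μ : Measure X)
    (F : X → ℂ) : ℝ≥0∞ :=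
  sInf (ENNReal.ofReal '' {b : ℝ | 0 < b ∧ ∫⁻ x, Φ (‖F x‖ₑ / ENNReal.ofReal b) ∂μ ≤ 1})

/-- Membership in the Orlicz space `L^Φ(μ)`. -/
def MemOrlicz {X : Type*} [MeasurableSpace X] (Φ : ℝ≥0∞ → ℝ≥0∞) (μ : Measure X)
    (F : X → ℂ) : Prop :=
  AEStronglyMeasurable F μ ∧ luxemburgNorm Φ μ F < ⊤

/-- Membership in the Orlicz modulation space `M^Φ(ℤⁿ)` defined with the window `γ`. -/
def MemOrliczModulation {n : ℕ} (γ : SchwartzLattice n) (Φ : ℝ≥0∞ → ℝ≥0∞)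
    (u : TemperedLattice n) : Prop :=
  MemOrlicz Φ (phaseMeasure n) (stft γ u)

/-! ### The Schwartz space of `ℤⁿ × 𝕋ⁿ`, tempered distributions, modulation spaces -/

/-- The `ℤⁿ`-periodic function on `ℝⁿ` given by the slice `F(k, ·)` of a function on `ℤⁿ × 𝕋ⁿ`. -/
def lift {n : ℕ} (F : Phase n → ℂ) (k : Lattice n) (x : Fin n → ℝ) : ℂ :=
  F (k, fun i => (x i : UnitAddCircle))

lemma bound_of_torus_smooth {n : ℕ} {e : Torus n → ℂ}
    (he : ContDiff ℝ ∞ fun x : Fin n → ℝ => e fun i => (x i : UnitAddCircle)) (l : ℕ) :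
    ∃ C : ℝ, ∀ x, ‖iteratedFDeriv ℝ l
      (fun x : Fin n → ℝ => e fun i => (x i : UnitAddCircle)) x‖ ≤ C := by
  set h : (Fin n → ℝ) → ℂ := fun x => e fun i => (x i : UnitAddCircle) with hh
  have hcont : Continuous fun x => iteratedFDeriv ℝ l h x :=
    he.continuous_iteratedFDeriv (by exact_mod_cast le_top)
  obtain ⟨C, hC⟩ := (isCompact_Icc (a := (0 : Fin n → ℝ)) (b := 1)).exists_bound_of_continuousOn
    hcont.continuousOn
  refine ⟨C, fun x => ?_⟩
  set a : Fin n → ℝ := fun i => (⌊x i⌋ : ℝ) with ha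
  have hper : (fun y => h (y - a)) = h := by
    funext y
    simp only [hh]
    congr 1
    funext i
    simp only [Pi.sub_apply, ha, AddCircle.coe_sub]
    have : ((⌊x i⌋ : ℝ) : UnitAddCircle) = 0 := by
      rw [AddCircle.coe_eq_zero_iff]; exact ⟨⌊x i⌋, by simp⟩
    rw [this, sub_zero]
  have := iteratedFDeriv_comp_sub (𝕜 := ℝ) (f := h) l a x
  rw [hper] at this
  rw [this]
  refine hC _ ⟨fun i => ?_, fun i => ?_⟩
  · simp [ha]
  · simp only [Pi.sub_apply, Pi.one_apply, ha]; linarith [Int.lt_floor_add_one (x i)]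

/-- Functions on `ℤⁿ × 𝕋ⁿ` that are smooth in the torus variable and, with all torus
derivatives, rapidly decreasing in the lattice variable. -/
def schwartzPhaseSubmodule (n : ℕ) : Submodule ℂ (Phase n → ℂ) where
  carrier := {F | (∀ k, ContDiff ℝ ∞ (lift F k)) ∧
    ∀ j l : ℕ, ∃ C : ℝ, ∀ k x, (1 + ‖k‖) ^ j * ‖iteratedFDeriv ℝ l (lift F k) x‖ ≤ C}
  zero_mem' := by
    have h : ∀ k, lift (0 : Phase n → ℂ) k = 0 := fun k => rfl
    refine ⟨fun k => by rw [h]; exact contDiff_zero_fun, fun j l => ⟨0, fun k x => ?_⟩⟩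
    rw [h, show (0 : (Fin n → ℝ) → ℂ) = fun _ => 0 from rfl, iteratedFDeriv_fun_zero]
    simp
  add_mem' := by
    rintro F G ⟨hF, hF'⟩ ⟨hG, hG'⟩
    have h : ∀ k, lift (F + G) k = lift F k + lift G k := fun k => rfl
    refine ⟨fun k => by rw [h]; exact (hF k).add (hG k), fun j l => ?_⟩
    obtain ⟨C, hC⟩ := hF' j l
    obtain ⟨D, hD⟩ := hG' j l
    refine ⟨C + D, fun k x => ?_⟩
    rw [h, iteratedFDeriv_add_apply ((hF k).of_le (by exact_mod_cast le_top)).contDiffAt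
      ((hG k).of_le (by exact_mod_cast le_top)).contDiffAt]
    refine (mul_le_mul_of_nonneg_left (norm_add_le _ _) (by positivity)).trans ?_
    rw [mul_add]; exact add_le_add (hC k x) (hD k x)
  smul_mem' := by
    rintro c F ⟨hF, hF'⟩
    have h : ∀ k, lift (c • F) k = c • lift F k := fun k => rfl
    refine ⟨fun k => by rw [h]; exact contDiff_const.smul (hF k), fun j l => ?_⟩
    obtain ⟨C, hC⟩ := hF' j l
    refine ⟨‖c‖ * C, fun k x => ?_⟩
    rw [h, iteratedFDeriv_const_smul_apply ((hF k).of_le (by exact_mod_cast le_top)).contDiffAt,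
      norm_smul, mul_left_comm]
    exact mul_le_mul_of_nonneg_left (hC k x) (norm_nonneg c)

/-- The Schwartz space `𝒮(ℤⁿ × 𝕋ⁿ)`. -/
def SchwartzPhase (n : ℕ) : Type := schwartzPhaseSubmodule n

namespace SchwartzPhase

variable {n : ℕ}

instance : AddCommGroup (SchwartzPhase n) :=
  inferInstanceAs (AddCommGroup (schwartzPhaseSubmodule n))

instance : Module ℂ (SchwartzPhase n) :=
  inferInstanceAs (Module ℂ (schwartzPhaseSubmodule n))

instance : CoeFun (SchwartzPhase n) (fun _ => Phase n → ℂ) := ⟨fun F => F.1⟩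

lemma bddAbove (F : SchwartzPhase n) (j l : ℕ) :
    BddAbove (Set.range fun z : Lattice n × (Fin n → ℝ) =>
      (1 + ‖z.1‖) ^ j * ‖iteratedFDeriv ℝ l (lift F z.1) z.2‖) := by
  obtain ⟨C, hC⟩ := F.2.2 j l
  exact ⟨C, by rintro _ ⟨z, rfl⟩; exact hC z.1 z.2⟩

/-- The seminorm `sup_{k, x} (1 + |k|)^j |D^l F(k, x)|`, where `D` is the derivative in the torus
variable. -/
def seminorm (n : ℕ) (q : ℕ × ℕ) : Seminorm ℂ (SchwartzPhase n) :=
  Seminorm.of (fun F => ⨆ z : Lattice n × (Fin n → ℝ),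
      (1 + ‖z.1‖) ^ q.1 * ‖iteratedFDeriv ℝ q.2 (lift F z.1) z.2‖)
    (by
      intro F G
      refine ciSup_le fun z => ?_
      have h : lift (F + G : SchwartzPhase n) z.1 = lift F z.1 + lift G z.1 := rfl
      rw [h, iteratedFDeriv_add_apply ((F.2.1 _).of_le (by exact_mod_cast le_top)).contDiffAt
        ((G.2.1 _).of_le (by exact_mod_cast le_top)).contDiffAt]
      refine (mul_le_mul_of_nonneg_left (norm_add_le _ _) (by positivity)).trans ?_
      rw [mul_add]
      exact add_le_add (le_ciSup (bddAbove F q.1 q.2) z) (le_ciSup (bddAbove G q.1 q.2) z))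
    (by
      intro c F
      rw [Real.mul_iSup_of_nonneg (norm_nonneg c)]
      refine congrArg _ (funext fun z => ?_)
      have h : lift (c • F : SchwartzPhase n) z.1 = c • lift F z.1 := rfl
      rw [h, iteratedFDeriv_const_smul_apply
        ((F.2.1 _).of_le (by exact_mod_cast le_top)).contDiffAt, norm_smul, mul_left_comm])

/-- The topology generated by these seminorms. -/
instance : TopologicalSpace (SchwartzPhase n) :=
  SeminormFamily.moduleFilterBasis (𝕜 := ℂ) (seminorm n) |>.topology

lemma withSeminorms (n : ℕ) :
    WithSeminorms (𝕜 := ℂ) (E := SchwartzPhase n) (seminorm n) := ⟨rfl⟩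

/-- Translation `(T_{(m,θ)} F)(j, η) = F(j - m, η - θ)`. -/
def translate (z : Phase n) (F : SchwartzPhase n) : SchwartzPhase n :=
  ⟨fun p => F (p - z), by
    obtain ⟨m, θ⟩ := z
    choose a ha using fun i => QuotientAddGroup.mk_surjective (θ i)
    have h : ∀ k, lift (fun p => F (p - (m, θ))) k = fun x => lift F (k - m) (x - a) := by
      intro k
      funext x
      simp only [lift, Prod.mk_sub_mk]
      refine congrArg (fun t => F (k - m, t)) (funext fun i => ?_)
      simp only [Pi.sub_apply, AddCircle.coe_sub]
      rw [← ha i]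
    refine ⟨fun k => by rw [h]; exact (F.2.1 _).comp (contDiff_id.sub contDiff_const),
      fun j l => ?_⟩
    obtain ⟨C, hC⟩ := F.2.2 j l
    refine ⟨(1 + ‖m‖) ^ j * C, fun k x => ?_⟩
    have hk : (1 + ‖k‖) ≤ (1 + ‖m‖) * (1 + ‖k - m‖) := by
      have : ‖k‖ ≤ ‖k - m‖ + ‖m‖ := by simpa using norm_add_le (k - m) m
      nlinarith [mul_nonneg (norm_nonneg m) (norm_nonneg (k - m))]
    rw [h, iteratedFDeriv_comp_sub]
    calc (1 + ‖k‖) ^ j * ‖iteratedFDeriv ℝ l (lift F (k - m)) (x - a)‖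
        ≤ ((1 + ‖m‖) * (1 + ‖k - m‖)) ^ j * ‖iteratedFDeriv ℝ l (lift F (k - m)) (x - a)‖ := by
          gcongr
      _ = (1 + ‖m‖) ^ j * ((1 + ‖k - m‖) ^ j *
            ‖iteratedFDeriv ℝ l (lift F (k - m)) (x - a)‖) := by rw [mul_pow]; ring
      _ ≤ _ := by gcongr; exact hC _ _⟩

/-- Modulation `(M_{(ξ,k)} F)(j, η) = e^{2πi j·ξ} e^{2πi k·η} F(j, η)`. -/
def modulate (ζ : Torus n × Lattice n) (F : SchwartzPhase n) : SchwartzPhase n :=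
  ⟨fun p => character p.1 ζ.1 * character ζ.2 p.2 * F p, by
    obtain ⟨ξ, r⟩ := ζ
    set e : (Fin n → ℝ) → ℂ := fun x => character r (fun i => (x i : UnitAddCircle)) with hedef
    have he : ContDiff ℝ ∞ e := by
      simp only [hedef, character, UnitAddTorus.mFourier, ContinuousMap.coe_mk, fourier_coe_apply]
      refine contDiff_prod fun i _ => ?_
      have : ContDiff ℝ ∞ fun x : Fin n → ℝ => ((x i : ℝ) : ℂ) :=
        Complex.ofRealCLM.contDiff.comp (contDiff_apply ℝ ℝ i)
      exact ((contDiff_const.mul this).div_const _).cexp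
    have h : ∀ k, lift (fun p => character p.1 ξ * character r p.2 * F p) k =
        fun x => (character k ξ • e x) * lift F k x := fun k => rfl
    have he' : ∀ k, ContDiff ℝ ∞ fun x => character k ξ • e x :=
      fun k => (contDiff_const (c := character k ξ)).smul he
    refine ⟨fun k => by rw [h]; exact (he' k).mul (F.2.1 k), fun j l => ?_⟩
    choose B hB using fun i => bound_of_torus_smooth (e := fun w => character r w) he i
    choose C hC using fun i => F.2.2 j i
    refine ⟨∑ i ∈ Finset.range (l + 1), (l.choose i : ℝ) * B i * C (l - i), fun k x => ?_⟩
    rw [h]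
    refine (mul_le_mul_of_nonneg_left (norm_iteratedFDeriv_mul_le (he' k) (F.2.1 k) x
      (n := l) (by exact_mod_cast le_top)) (by positivity)).trans ?_
    rw [Finset.mul_sum]
    refine Finset.sum_le_sum fun i _ => ?_
    have h1 : ‖iteratedFDeriv ℝ i (fun x => character k ξ • e x) x‖ ≤ B i := by
      have : (fun x => character k ξ • e x) = character k ξ • e := rfl
      rw [this, iteratedFDeriv_const_smul_apply (he.of_le (by exact_mod_cast le_top)).contDiffAt,
        norm_smul, norm_character, one_mul]
      exact hB i x
    calc (1 + ‖k‖) ^ j * ((l.choose i : ℝ) *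
          ‖iteratedFDeriv ℝ i (fun x => character k ξ • e x) x‖ *
          ‖iteratedFDeriv ℝ (l - i) (lift F k) x‖)
        = (l.choose i : ℝ) * ‖iteratedFDeriv ℝ i (fun x => character k ξ • e x) x‖ *
          ((1 + ‖k‖) ^ j * ‖iteratedFDeriv ℝ (l - i) (lift F k) x‖) := by ring
      _ ≤ (l.choose i : ℝ) * B i * C (l - i) := by
          have := (norm_nonneg _).trans h1
          gcongr
          exact hC _ k x⟩

/-- Pointwise complex conjugate. -/
def conjugate (F : SchwartzPhase n) : SchwartzPhase n :=
  ⟨fun p => conj (F p), by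
    have h : ∀ k, lift (fun p => conj (F p)) k = Complex.conjLIE ∘ lift F k := fun k => rfl
    refine ⟨fun k => by rw [h]; exact Complex.conjLIE.contDiff.comp (F.2.1 k), fun j l => ?_⟩
    obtain ⟨C, hC⟩ := F.2.2 j l
    refine ⟨C, fun k x => ?_⟩
    rw [h, LinearIsometryEquiv.norm_iteratedFDeriv_comp_left]
    exact hC k x⟩

end SchwartzPhase

/-- Tempered distributions `𝒮'(ℤⁿ × 𝕋ⁿ)`: continuous linear functionals on `𝒮(ℤⁿ × 𝕋ⁿ)`. -/
abbrev TemperedPhase (n : ℕ) : Type := SchwartzPhase n →L[ℂ] ℂ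

/-- The short-time Fourier transform `V_G U (m, ω, ξ, k) = ⟨U, M_{(ξ,k)} T_{(m,ω)} G⟩` of a tempered
distribution on `ℤⁿ × 𝕋ⁿ` with window `G ∈ 𝒮(ℤⁿ × 𝕋ⁿ)`. -/
def stftPhase {n : ℕ} (G : SchwartzPhase n) (U : TemperedPhase n)
    (z : Phase n × (Torus n × Lattice n)) : ℂ :=
  U (SchwartzPhase.modulate z.2 (SchwartzPhase.translate z.1 G)).conjugate

/-- Membership in the modulation space `M^p(ℤⁿ × 𝕋ⁿ)` defined with the window `G`. -/
def MemModulationPhase {n : ℕ} (G : SchwartzPhase n) (p : ℝ≥0∞) (U : TemperedPhase n) : Prop :=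
  MemLp (stftPhase G U) p (phaseDualMeasure n)

/-- The tempered distribution `U` on `ℤⁿ × 𝕋ⁿ` is (integration against) the function `σ`. -/
def TemperedPhase.IsFunction {n : ℕ} (U : TemperedPhase n) (σ : Phase n → ℂ) : Prop :=
  AEStronglyMeasurable σ (phaseMeasure n) ∧
    ∀ φ : SchwartzPhase n, Integrable (fun z => σ z * φ z) (phaseMeasure n) ∧
      U φ = ∫ z, σ z * φ z ∂(phaseMeasure n)

/-! ### Localization operators -/

/-- The Hilbert space `ℓ²(ℤⁿ)`. -/
abbrev EllTwo (n : ℕ) : Type := lp (fun _ : Lattice n => ℂ) 2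

/-- The short-time Fourier transform `V_g f (m, w) = ∑ₖ f(k) conj(g(k - m)) e^{-2πi w·k}` of a
function `f` on `ℤⁿ` with respect to a function `g` on `ℤⁿ`. -/
def stftFun {n : ℕ} (g f : Lattice n → ℂ) (z : Phase n) : ℂ :=
  ∑' k, f k * conj (character k z.2 * g (k - z.1))

/-- `L` is the localization operator on `ℓ²(ℤⁿ)` with symbol `σ` and windows `g₁`, `g₂`:
`(L f)(k) = ∑ₘ ∫ σ(m,w) V_{g₁}f(m,w) (M_w T_m g₂)(k) dw`, where the series defining `V_{g₁} f` and
the sum-integral, written as an integral over `ℤⁿ × 𝕋ⁿ`, converge absolutely. -/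
def IsLocalizationOperator {n : ℕ} (σ : Phase n → ℂ) (g₁ g₂ : Lattice n → ℂ)
    (L : EllTwo n →L[ℂ] EllTwo n) : Prop :=
  ∀ f : EllTwo n,
    (∀ z : Phase n, Summable fun k => f k * conj (character k z.2 * g₁ (k - z.1))) ∧
    ∀ k : Lattice n,
      Integrable (fun z : Phase n => σ z * stftFun g₁ f z * (character k z.2 * g₂ (k - z.1)))
        (phaseMeasure n) ∧
      L f k = ∫ z : Phase n, σ z * stftFun g₁ f z * (character k z.2 * g₂ (k - z.1))
        ∂(phaseMeasure n)

end DiscreteTF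

end

noncomputable section

namespace DiscreteTF

/-! ### Characters and Fourier coefficients on the torus -/

/-! The operator is Hilbert–Schmidt, hence bounded and compact. Both hypotheses enter only through
square summability: the windows lie in `ℓ²(ℤⁿ)` and the symbol lies in `L²(ℤⁿ × 𝕋ⁿ)`.

Windows. For fixed `m`, `V_γ u(m, ·)` is an absolutely convergent Fourier series with coefficients
`conj (γ (k - m)) * u k`, so each coefficient is at most the `L¹(𝕋ⁿ)` norm of that slice. For `x ≤
e^{-3/2}` one has `Φ(x) ≥ x²`, and by convexity `Φ(x) ≥ e^{-3/2} x` above this threshold. Finiteness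
of the `Φ`-integral therefore splits `V_γ u` into an `L²` part and an `L¹` part. The torus has mass
one and `ℓ¹ ⊂ ℓ²`, so the slice norms of both parts are square summable in `m`
(`MemOrliczModulation.memℓp_two`).

Symbol. The same coefficient argument, now on `𝕋ⁿ × 𝕋ⁿ`, puts the numbers `U (monomial z)` in `ℓ^p ⊂
ℓ²` (`MemModulationPhase.memℓp_two`). Riesz–Fischer gives `σ ∈ L²` with these Fourier coefficients,
and the Fourier expansion of test functions identifies `U` with `σ` (`isFunction_of_torusCoeff_eq`).

Operator. Integrating out the torus variable turns the localization operator into the matrix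
`localizationKernel`. Its square sum is at most `‖g₁‖² ‖c‖² ‖g₂‖²` (`memℓp_localizationKernel`),
where `c` is the family of Fourier coefficients of `σ`. An operator with such a matrix is a norm
limit of finite-rank ones (`isCompactOperator_kernelOperator`). -/

instance (n : ℕ) : IsProbabilityMeasure (torusMeasure n) := by
  unfold torusMeasure; infer_instance

instance (n : ℕ) : Measure.IsAddHaarMeasure (torusMeasure n) := by
  unfold torusMeasure; infer_instance

section Torus

variable {n : ℕ}

/-- The projection `ℝⁿ → 𝕋ⁿ`. -/
def toTorus (x : Fin n → ℝ) : Torus n := fun i => (x i : UnitAddCircle)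

lemma isOpenQuotientMap_toTorus : IsOpenQuotientMap (toTorus (n := n)) :=
  IsOpenQuotientMap.piMap fun _ => QuotientAddGroup.isOpenQuotientMap_mk

lemma toTorus_add (x y : Fin n → ℝ) : toTorus (x + y) = toTorus x + toTorus y := by
  funext i; simp [toTorus]

lemma continuous_of_comp_toTorus {h : Torus n → ℂ} (hh : Continuous (h ∘ toTorus)) :
    Continuous h :=
  isOpenQuotientMap_toTorus.isQuotientMap.continuous_iff.2 hh

@[fun_prop]
lemma continuous_character (k : Lattice n) : Continuous (character k) :=
  (UnitAddTorus.mFourier k).continuous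

lemma character_add (k l : Lattice n) (w : Torus n) :
    character (k + l) w = character k w * character l w := UnitAddTorus.mFourier_add

lemma character_neg (k : Lattice n) (w : Torus n) :
    character (-k) w = conj (character k w) := UnitAddTorus.mFourier_neg

lemma character_sub (k l : Lattice n) (w : Torus n) :
    character (k - l) w = character k w * conj (character l w) := by
  rw [sub_eq_add_neg, character_add, character_neg]

lemma character_zero (w : Torus n) : character 0 w = 1 := by
  simp [character, UnitAddTorus.mFourier_zero]

lemma character_add_right (k : Lattice n) (v w : Torus n) :
    character k (v + w) = character k v * character k w := by
  simp only [character, UnitAddTorus.mFourier, fourier_apply, ContinuousMap.coe_mk, Pi.add_apply,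
    smul_add, AddCircle.toCircle_add, Circle.coe_mul, Finset.prod_mul_distrib]

lemma character_neg_right (k : Lattice n) (w : Torus n) :
    character k (-w) = conj (character k w) := by
  rw [← character_neg]
  simp [character, UnitAddTorus.mFourier, fourier_apply]

lemma character_mul_conj (k : Lattice n) (w : Torus n) :
    character k w * conj (character k w) = 1 := by
  rw [Complex.mul_conj, Complex.normSq_eq_norm_sq, norm_character]; simp

lemma integral_character (k : Lattice n) :
    ∫ w, character k w ∂torusMeasure n = if k = 0 then 1 else 0 := by
  split_ifs with h
  · subst h; simp [character_zero]
  have h1 : ∫ w, character k w ∂torusMeasure n = ∏ i, ∫ t, fourier (k i) t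
      ∂(AddCircle.haarAddCircle (T := 1)) := integral_fintype_prod_eq_prod _
  obtain ⟨i, hi⟩ := Function.ne_iff.mp h
  rw [h1]
  refine Finset.prod_eq_zero (Finset.mem_univ i) ?_
  exact integral_eq_zero_of_add_right_eq_neg (μ := AddCircle.haarAddCircle)
    (fourier_add_half_inv_index hi (by norm_num))

/-- The Fourier coefficient `∫ h(w) e^{-2πi b·w} dw` of a function on the torus. -/
def torusCoeff (h : Torus n → ℂ) (b : Lattice n) : ℂ :=
  ∫ w, conj (character b w) * h w ∂torusMeasure n

lemma integrable_torus_of_continuous {E : Type*} [NormedAddCommGroup E] {h : Torus n → E}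
    (hh : Continuous h) : Integrable h (torusMeasure n) :=
  hh.integrable_of_hasCompactSupport (HasCompactSupport.of_compactSpace h)

lemma torusCoeff_translate (h : Torus n → ℂ) (b : Lattice n) (v : Torus n) :
    torusCoeff (fun w => h (w + v)) b = character b v * torusCoeff h b := by
  unfold torusCoeff
  rw [← integral_add_right_eq_self (fun w => conj (character b w) * h w) v,
    ← integral_const_mul]
  refine integral_congr_ae (ae_of_all _ fun w => ?_)
  dsimp only
  rw [character_add_right, map_mul]
  linear_combination (-(conj (character b w) * h (w + v))) * character_mul_conj b v

lemma norm_torusCoeff_le_of_bound {h : Torus n → ℂ} {C : ℝ} (hC : ∀ w, ‖h w‖ ≤ C)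
    (b : Lattice n) : ‖torusCoeff h b‖ ≤ C := by
  refine (norm_integral_le_of_norm_le_const (C := C) (ae_of_all _ fun w => ?_)).trans ?_
  · rw [norm_mul, RCLike.norm_conj, norm_character, one_mul]; exact hC w
  · simp

lemma torusCoeff_sub_translate {h : Torus n → ℂ} (hh : Continuous h) (b : Lattice n)
    (v : Torus n) :
    torusCoeff (fun w => h (w + v) - h w) b = (character b v - 1) * torusCoeff h b := by
  have hc : Continuous fun w => conj (character b w) :=
    Complex.continuous_conj.comp (continuous_character b)
  rw [sub_mul, one_mul, ← torusCoeff_translate]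
  unfold torusCoeff
  rw [← integral_sub]
  · simp_rw [mul_sub]
  · exact integrable_torus_of_continuous (hc.mul (hh.comp (continuous_add_const v)))
  · exact integrable_torus_of_continuous (hc.mul hh)

/-- A Fourier coefficient at a frequency whose character takes the value `-1` at `v` is
controlled by iterated differences with step `v`. -/
lemma two_pow_mul_norm_torusCoeff_le {b : Lattice n} {v : Fin n → ℝ}
    (hv : character b (toTorus v) = -1) (M : ℕ) :
    ∀ {h : Torus n → ℂ} {C : ℝ}, ContDiff ℝ ∞ (h ∘ toTorus) →
      (∀ x, ‖iteratedFDeriv ℝ M (h ∘ toTorus) x‖ ≤ C) →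
      2 ^ M * ‖torusCoeff h b‖ ≤ ‖v‖ ^ M * C := by
  induction M with
  | zero =>
    intro h C _ hC
    simp only [pow_zero, one_mul]
    refine norm_torusCoeff_le_of_bound (fun w => ?_) b
    obtain ⟨x, rfl⟩ := isOpenQuotientMap_toTorus.surjective w
    simpa using hC x
  | succ M ih =>
    intro h C hh hC
    have hd : (fun w => h (w + toTorus v) - h w) ∘ toTorus =
        (fun x => (h ∘ toTorus) (x + v)) - h ∘ toTorus := by
      funext x; simp [toTorus_add]
    have hs : ContDiff ℝ ∞ fun x => (h ∘ toTorus) (x + v) :=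
      hh.comp (contDiff_id.add contDiff_const)
    -- By the mean value inequality, the `M`-th derivative of the difference is bounded by `‖v‖`
    -- times the bound on the derivative of order `M + 1`.
    have key := ih (h := fun w => h (w + toTorus v) - h w) (C := C * ‖v‖)
      (by rw [hd]; exact hs.sub hh) (fun x => by
        rw [hd, iteratedFDeriv_sub_apply (hs.of_le (by exact_mod_cast le_top)).contDiffAt
          (hh.of_le (by exact_mod_cast le_top)).contDiffAt, iteratedFDeriv_comp_add_right]
        have := (convex_univ (E := Fin n → ℝ)).norm_image_sub_le_of_norm_fderiv_le (𝕜 := ℝ)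
          (f := iteratedFDeriv ℝ M (h ∘ toTorus)) (x := x) (y := x + v) (C := C)
          (fun y _ => ((hh.differentiable_iteratedFDeriv (m := M)
            (by exact_mod_cast WithTop.coe_lt_top _)) y))
          (fun y _ => by rw [norm_fderiv_iteratedFDeriv]; exact hC y) trivial trivial
        simpa using this)
    -- Differencing multiplies the coefficient by `character b v - 1 = -2`; each difference gains a
    -- factor 2.
    rw [torusCoeff_sub_translate (continuous_of_comp_toTorus hh.continuous), hv, norm_mul] at key
    have h2 : ‖(-1 - 1 : ℂ)‖ = 2 := by norm_num
    rw [h2] at key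
    calc 2 ^ (M + 1) * ‖torusCoeff h b‖ = 2 ^ M * (2 * ‖torusCoeff h b‖) := by ring
      _ ≤ _ := key
      _ = _ := by ring

lemma character_toTorus (b : Lattice n) (x : Fin n → ℝ) :
    character b (toTorus x) = Complex.exp (2 * Real.pi * Complex.I * (∑ i, b i * x i : ℝ)) := by
  simp only [character, UnitAddTorus.mFourier, ContinuousMap.coe_mk, toTorus, fourier_coe_apply,
    ← Complex.exp_sum]
  congr 1
  push_cast
  rw [Finset.mul_sum]
  refine Finset.sum_congr rfl fun i _ => ?_
  simp; ring

lemma one_le_norm_of_ne_zero {b : Lattice n} (hb : b ≠ 0) : 1 ≤ ‖b‖ := by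
  obtain ⟨i, hi⟩ := Function.ne_iff.mp hb
  have h1 : (1 : ℝ) ≤ ‖b i‖ := by
    rw [Int.norm_eq_abs]; exact_mod_cast Int.one_le_abs hi
  exact h1.trans (norm_le_pi_norm b i)

/-- Fourier coefficients of smooth functions decrease rapidly. -/
lemma one_add_norm_pow_mul_norm_torusCoeff_le {h : Torus n → ℂ} {C D : ℝ} {M : ℕ}
    (hh : ContDiff ℝ ∞ (h ∘ toTorus))
    (hD : ∀ x, ‖iteratedFDeriv ℝ 0 (h ∘ toTorus) x‖ ≤ D)
    (hC : ∀ x, ‖iteratedFDeriv ℝ M (h ∘ toTorus) x‖ ≤ C) (b : Lattice n) :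
    (1 + ‖b‖) ^ M * ‖torusCoeff h b‖ ≤ D + C := by
  have hC0 : 0 ≤ C := (norm_nonneg _).trans (hC 0)
  have hD0 : 0 ≤ D := (norm_nonneg _).trans (hD 0)
  -- The zero frequency gains nothing from derivatives; it accounts for the term `D`.
  by_cases hb : b = 0
  · subst hb
    have : ‖torusCoeff h 0‖ ≤ D := by
      refine norm_torusCoeff_le_of_bound (fun w => ?_) 0
      obtain ⟨x, rfl⟩ := isOpenQuotientMap_toTorus.surjective w
      simpa using hD x
    simp only [norm_zero, add_zero, one_pow, one_mul]
    linarith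
  have h1 := one_le_norm_of_ne_zero hb
  have hne : Nonempty (Fin n) := by
    obtain ⟨i, -⟩ := Function.ne_iff.mp hb
    exact ⟨i⟩
  obtain ⟨i, hi⟩ : ∃ i, ‖b i‖ = ‖b‖ := by
    obtain ⟨i, -, hi⟩ := Finset.exists_mem_eq_sup' Finset.univ_nonempty (fun i => ‖b i‖)
    refine ⟨i, le_antisymm (norm_le_pi_norm b i) ((pi_norm_le_iff_of_nonneg (norm_nonneg _)).2
      fun j => ?_)⟩
    rw [← hi]
    exact Finset.le_sup' (fun i => ‖b i‖) (Finset.mem_univ j)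
  have hbi : (b i : ℝ) ≠ 0 := by
    intro h0
    have : ‖b i‖ = 0 := by rw [Int.norm_eq_abs]; simp [h0]
    linarith
  -- With `i` a coordinate of maximal modulus, `b · v = 1/2` makes the character equal to `-1`,
  -- while `‖v‖ = 1/(2‖b‖)` is small enough to gain `‖b‖` per derivative.
  set v : Fin n → ℝ := Pi.single i (1 / (2 * b i)) with hvdef
  have hvb : character b (toTorus v) = -1 := by
    rw [character_toTorus]
    have : (∑ j, b j * v j : ℝ) = 1 / 2 := by
      rw [Finset.sum_eq_single i]
      · simp only [hvdef, Pi.single_eq_same]; field_simp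
      · intro j _ hj; simp [hvdef, Pi.single_eq_of_ne hj]
      · simp
    rw [this, ← Complex.exp_pi_mul_I]
    congr 1; push_cast; ring
  have hvn : ‖v‖ = 1 / (2 * ‖b‖) := by
    rw [hvdef, Pi.norm_single, ← hi, Int.norm_eq_abs, Real.norm_eq_abs, abs_div, abs_mul]
    norm_num
  have key := two_pow_mul_norm_torusCoeff_le hvb M hh hC
  rw [hvn] at key
  have hpos : 0 < 2 * ‖b‖ := by linarith
  have key2 : (2 * (2 * ‖b‖)) ^ M * ‖torusCoeff h b‖ ≤ C := by
    have := mul_le_mul_of_nonneg_left key (pow_nonneg hpos.le M)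
    calc (2 * (2 * ‖b‖)) ^ M * ‖torusCoeff h b‖
        = (2 * ‖b‖) ^ M * (2 ^ M * ‖torusCoeff h b‖) := by rw [mul_pow]; ring
      _ ≤ _ := this
      _ = C := by rw [← mul_assoc, ← mul_pow, mul_one_div_cancel hpos.ne', one_pow, one_mul]
  -- Since `‖b‖ ≥ 1`, one has `1 + ‖b‖ ≤ 4‖b‖`.
  calc (1 + ‖b‖) ^ M * ‖torusCoeff h b‖ ≤ (2 * (2 * ‖b‖)) ^ M * ‖torusCoeff h b‖ := by
        gcongr; linarith
    _ ≤ C := key2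
    _ ≤ D + C := by linarith

lemma contDiff_character (b : Lattice n) : ContDiff ℝ ∞ (character b ∘ toTorus) := by
  have : character b ∘ toTorus = fun x => Complex.exp (2 * Real.pi * Complex.I *
      ((∑ i, b i * x i : ℝ) : ℂ)) := funext fun x => character_toTorus b x
  rw [this]
  refine (contDiff_const.mul (Complex.ofRealCLM.contDiff.comp ?_)).cexp
  exact ContDiff.sum fun i (_ : i ∈ Finset.univ) => contDiff_const.mul (contDiff_apply ℝ ℝ i)

lemma iteratedDeriv_cexp_mul_ofReal (a : ℂ) (l : ℕ) :
    iteratedDeriv l (fun t : ℝ => Complex.exp (a * t)) =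
      fun t : ℝ => a ^ l * Complex.exp (a * t) := by
  induction l with
  | zero => simp
  | succ l ih =>
    rw [iteratedDeriv_succ, ih]
    funext t
    have h1 : HasDerivAt (fun t : ℝ => a * (t : ℂ)) a t := by
      simpa using (Complex.ofRealCLM.hasDerivAt (x := t)).const_mul a
    rw [(h1.cexp.const_mul (a ^ l)).deriv]
    ring

/-- The lifted character is a one-variable exponential composed with the functional `x ↦ b · x`,
whose norm is at most `n‖b‖` for the sup norm. Only polynomial growth in `b` matters, so `‖b‖` is
relaxed to `1 + ‖b‖`. -/
lemma norm_iteratedFDeriv_character_le (b : Lattice n) (l : ℕ) (x : Fin n → ℝ) :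
    ‖iteratedFDeriv ℝ l (character b ∘ toTorus) x‖ ≤ (2 * Real.pi * n) ^ l * (1 + ‖b‖) ^ l := by
  set A : (Fin n → ℝ) →L[ℝ] ℝ := ∑ i, (b i : ℝ) • ContinuousLinearMap.proj i with hA
  have hAx : ∀ x, A x = ∑ i, (b i : ℝ) * x i := fun x => by simp [hA]
  set e : ℝ → ℂ := fun t => Complex.exp (2 * Real.pi * Complex.I * t) with he
  have hcomp : character b ∘ toTorus = e ∘ A := by
    funext x; simp only [Function.comp_apply, character_toTorus, he, hAx]
  have hes : ContDiff ℝ ∞ e :=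
    (contDiff_const.mul Complex.ofRealCLM.contDiff).cexp
  have hAn : ‖A‖ ≤ n * (1 + ‖b‖) := by
    refine A.opNorm_le_bound (by positivity) fun x => ?_
    rw [hAx]
    calc ‖∑ i, (b i : ℝ) * x i‖ ≤ ∑ i : Fin n, ‖b‖ * ‖x‖ := by
          refine norm_sum_le_of_le _ fun i _ => ?_
          rw [norm_mul]
          gcongr
          · have := norm_le_pi_norm b i
            rwa [Int.norm_eq_abs] at this
          · exact norm_le_pi_norm x i
      _ = n * (‖b‖ * ‖x‖) := by simp
      _ ≤ n * (1 + ‖b‖) * ‖x‖ := by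
          rw [mul_assoc]; gcongr; linarith
  rw [hcomp, A.iteratedFDeriv_comp_right hes x (i := l) (by exact_mod_cast le_top)]
  refine (ContinuousMultilinearMap.norm_compContinuousLinearMap_le _ _).trans ?_
  rw [norm_iteratedFDeriv_eq_norm_iteratedDeriv, he, iteratedDeriv_cexp_mul_ofReal]
  have h1 : ‖Complex.exp (2 * Real.pi * Complex.I * (A x : ℂ))‖ = 1 := by
    rw [show (2 * Real.pi * Complex.I * (A x : ℂ)) = ((2 * Real.pi * A x : ℝ) : ℂ) * Complex.I by
      push_cast; ring]
    exact Complex.norm_exp_ofReal_mul_I _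
  have h2 : ‖(2 * Real.pi * Complex.I : ℂ)‖ = 2 * Real.pi := by
    simp [abs_of_pos Real.pi_pos]
  rw [norm_mul, h1, norm_pow, h2, mul_one, Finset.prod_const, Finset.card_univ, Fintype.card_fin,
    ← mul_pow, ← mul_pow, mul_assoc (2 * Real.pi)]
  gcongr

end Torus

/-! ### Summability over lattices -/

lemma summable_prod_pi {f : ℤ → ℝ} (hf0 : ∀ k, 0 ≤ f k) (hf : Summable f) :
    ∀ n : ℕ, Summable fun b : Lattice n => ∏ i, f (b i)
  | 0 => Summable.of_finite
  | n + 1 => by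
    rw [← (Fin.consEquiv fun _ : Fin (n + 1) => ℤ).summable_iff]
    have := hf.mul_of_nonneg (summable_prod_pi hf0 hf n) hf0
      fun b => Finset.prod_nonneg fun i _ => hf0 _
    refine this.congr fun p => ?_
    simp [Fin.consEquiv, Fin.prod_univ_succ]

/-- The sup norm dominates every coordinate, so the exponent `2 * n` supplies a summable factor `(1
+ |b i|)⁻²` for each of the `n` coordinates. -/
lemma summable_one_add_norm_pow_inv (n : ℕ) :
    Summable fun b : Lattice n => ((1 + ‖b‖) ^ (2 * n))⁻¹ := by
  have hf : Summable fun k : ℤ => ((1 + ‖k‖) ^ 2)⁻¹ := by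
    have h1 : Summable fun k : ℤ => |((k : ℝ) ^ 2)⁻¹| :=
      (by simpa using (Real.summable_one_div_int_pow (p := 2)).2 (by norm_num) :
        Summable fun k : ℤ => ((k : ℝ) ^ 2)⁻¹).abs
    have h2 : Summable fun k : ℤ => if k = 0 then (1 : ℝ) else 0 :=
      (hasSum_ite_eq (0 : ℤ) (1 : ℝ)).summable
    refine Summable.of_nonneg_of_le (fun k => by positivity) (fun k => ?_) (h1.add h2)
    by_cases hk : k = 0
    · simp [hk]
    · have hk' : (k : ℝ) ≠ 0 := by exact_mod_cast hk
      simp only [hk, if_false, add_zero]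
      rw [abs_of_nonneg (by positivity), Int.norm_eq_abs]
      have : 0 < |(k : ℝ)| := abs_pos.2 hk'
      rw [← sq_abs (k : ℝ)]
      gcongr
      linarith
  refine Summable.of_nonneg_of_le (fun b => by positivity) (fun b => ?_)
    (summable_prod_pi (fun k => by positivity) hf n)
  rw [Finset.prod_inv_distrib]
  have hpos : 0 < ∏ i, (1 + ‖b i‖) ^ 2 := Finset.prod_pos fun i _ => by positivity
  refine inv_anti₀ hpos ?_
  calc ∏ i, (1 + ‖b i‖) ^ 2 ≤ ∏ _i : Fin n, (1 + ‖b‖) ^ 2 := by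
        refine Finset.prod_le_prod (fun i _ => by positivity) fun i _ => ?_
        have := norm_le_pi_norm b i
        gcongr
    _ = (1 + ‖b‖) ^ (2 * n) := by simp [pow_mul]

lemma summable_of_one_add_norm_pow_mul_le {n : ℕ} {c : Lattice n × Lattice n → ℝ} {C : ℝ}
    (hc0 : ∀ z, 0 ≤ c z)
    (hc : ∀ a b, (1 + ‖a‖) ^ (2 * n) * (1 + ‖b‖) ^ (2 * n) * c (a, b) ≤ C) : Summable c := by
  have h := ((summable_one_add_norm_pow_inv n).mul_of_nonneg (summable_one_add_norm_pow_inv n)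
    (fun b => by positivity) (fun b => by positivity)).mul_left C
  refine Summable.of_nonneg_of_le hc0 (fun z => ?_) h
  rw [← mul_inv, ← div_eq_mul_inv, le_div_iff₀ (by positivity), mul_comm]
  exact hc z.1 z.2

/-! ### Expansions in the Schwartz spaces -/

/-- Convergence is tested in one seminorm at a time, and tails of numerical series tend to zero
along finite sets. Both Schwartz expansions, in deltas and in monomials, rest on this criterion. -/
lemma hasSum_of_seminorm_sub_le_tsum {E ι κ : Type*} [AddCommGroup E] [Module ℂ E]
    [TopologicalSpace E] {p : SeminormFamily ℂ E ι} (hp : WithSeminorms p) {f : κ → E} {x : E}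
    (h : ∀ i, ∃ c : κ → ℝ, Summable c ∧
      ∀ s : Finset κ, p i (∑ k ∈ s, f k - x) ≤ ∑' k : {k // k ∉ s}, c k) : HasSum f x := by
  refine (hp.tendsto_nhds _ _).2 fun i ε hε => ?_
  obtain ⟨c, -, hc'⟩ := h i
  filter_upwards [(tendsto_tsum_compl_atTop_zero c).eventually (gt_mem_nhds hε)] with s hs
  exact (hc' s).trans_lt hs

lemma SchwartzLattice.sum_apply {n : ℕ} {κ : Type*} (s : Finset κ) (f : κ → SchwartzLattice n)
    (k : Lattice n) : (∑ i ∈ s, f i) k = ∑ i ∈ s, f i k := by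
  have : ((schwartzLatticeSubmodule n).subtype (∑ i ∈ s, f i)) =
      ∑ i ∈ s, (schwartzLatticeSubmodule n).subtype (f i) :=
    map_sum (schwartzLatticeSubmodule n).subtype f s
  exact (congrFun this k).trans (Finset.sum_apply k s _)

/-- Convergence in the Schwartz topology, not merely pointwise, lets a tempered distribution be
applied term by term; hence it is determined by its values on deltas. -/
lemma SchwartzLattice.hasSum_delta {n : ℕ} (φ : SchwartzLattice n) :
    HasSum (fun k => φ k • delta k) φ := by
  refine hasSum_of_seminorm_sub_le_tsum (withSeminorms n) fun j =>
    ⟨fun k => (1 + ‖k‖) ^ j * ‖φ k‖, ?_, fun s => ?_⟩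
  all_goals
    have hsum : Summable fun k => (1 + ‖k‖) ^ j * ‖φ k‖ := by
      -- The additional `2 * n` powers of decay pay for summation over the lattice.
      obtain ⟨C, hC⟩ := φ.2 (2 * n + j)
      refine Summable.of_nonneg_of_le (fun k => by positivity) (fun k => ?_)
        ((summable_one_add_norm_pow_inv n).mul_left C)
      rw [← div_eq_mul_inv, le_div_iff₀ (by positivity)]
      calc _ = (1 + ‖k‖) ^ (2 * n + j) * ‖φ k‖ := by rw [pow_add]; ring
        _ ≤ C := hC k
  · exact hsum
  · have hs' : Summable fun k : {k // k ∉ s} => (1 + ‖(k : Lattice n)‖) ^ j * ‖φ k‖ :=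
      hsum.subtype _
    refine ciSup_le fun k => ?_
    have hv : (∑ l ∈ s, φ l • delta l - φ) k = (∑ l ∈ s, if k = l then φ l else 0) - φ k := by
      have h1 : (∑ l ∈ s, φ l • delta l - φ) k = (∑ l ∈ s, φ l • delta l) k - φ k := rfl
      rw [h1, sum_apply]
      congr 1
      refine Finset.sum_congr rfl fun l _ => ?_
      rw [smul_apply]
      simp [delta]
    rw [hv, Finset.sum_ite_eq]
    by_cases hk : k ∈ s
    · simp only [hk, if_true, sub_self, norm_zero, mul_zero]
      exact tsum_nonneg fun k => by positivity
    · simp only [hk, if_false, zero_sub, norm_neg]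
      exact hs'.le_tsum ⟨k, hk⟩ fun _ _ => by positivity

namespace SchwartzPhase

variable {n : ℕ}

/-- The function `(k, w) ↦ δ_{k a} e^{2πi b·w}`. -/
def monomial (z : Lattice n × Lattice n) : SchwartzPhase n :=
  ⟨fun p => if p.1 = z.1 then character z.2 p.2 else 0, by
    have h : ∀ k, lift (fun p : Phase n => if p.1 = z.1 then character z.2 p.2 else 0) k =
        if k = z.1 then character z.2 ∘ toTorus else fun _ => 0 := by
      intro k
      funext x
      simp only [lift]
      split_ifs <;> rfl
    refine ⟨fun k => ?_, fun j l =>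
      ⟨(1 + ‖z.1‖) ^ j * ((2 * Real.pi * n) ^ l * (1 + ‖z.2‖) ^ l), fun k x => ?_⟩⟩
    · rw [h]
      split_ifs
      · exact contDiff_character _
      · exact contDiff_const
    · rw [h]
      split_ifs with hk
      · subst hk
        gcongr
        exact norm_iteratedFDeriv_character_le _ _ _
      · rw [iteratedFDeriv_fun_zero]
        simp only [Pi.zero_apply, norm_zero, mul_zero]
        positivity⟩

lemma monomial_apply (z : Lattice n × Lattice n) (p : Phase n) :
    monomial z p = if p.1 = z.1 then character z.2 p.2 else 0 := rfl

lemma norm_iteratedFDeriv_lift_monomial_le (z : Lattice n × Lattice n) (j l : ℕ) (k : Lattice n)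
    (x : Fin n → ℝ) :
    (1 + ‖k‖) ^ j * ‖iteratedFDeriv ℝ l (lift (monomial z) k) x‖ ≤
      (1 + ‖z.1‖) ^ j * ((2 * Real.pi * n) ^ l * (1 + ‖z.2‖) ^ l) := by
  have h : lift (monomial z) k = if k = z.1 then character z.2 ∘ toTorus else fun _ => 0 := by
    funext x
    simp only [lift, monomial_apply]
    split_ifs <;> rfl
  rw [h]
  split_ifs with hk
  · subst hk
    gcongr
    exact norm_iteratedFDeriv_character_le _ _ _
  · rw [iteratedFDeriv_fun_zero]
    simp only [Pi.zero_apply, norm_zero, mul_zero]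
    positivity

/-- The Fourier coefficient of the slice `φ(a, ·)` at `b`. -/
def coeff (φ : SchwartzPhase n) (z : Lattice n × Lattice n) : ℂ :=
  torusCoeff (fun w => φ (z.1, w)) z.2

lemma continuous_slice (φ : SchwartzPhase n) (k : Lattice n) : Continuous fun w => φ (k, w) :=
  continuous_of_comp_toTorus (φ.2.1 k).continuous

lemma coeff_decay (φ : SchwartzPhase n) (j M : ℕ) :
    ∃ C, ∀ a b, (1 + ‖a‖) ^ j * (1 + ‖b‖) ^ M * ‖coeff φ (a, b)‖ ≤ C := by
  obtain ⟨C, hC⟩ := φ.2.2 j M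
  obtain ⟨D, hD⟩ := φ.2.2 j 0
  refine ⟨D + C, fun a b => ?_⟩
  have hpos : 0 < (1 + ‖a‖) ^ j := by positivity
  have := one_add_norm_pow_mul_norm_torusCoeff_le (h := fun w => φ (a, w)) (φ.2.1 a)
    (D := D / (1 + ‖a‖) ^ j) (C := C / (1 + ‖a‖) ^ j) (M := M)
    (fun x => by rw [le_div_iff₀' hpos]; exact hD a x)
    (fun x => by rw [le_div_iff₀' hpos]; exact hC a x) b
  rw [← add_div, le_div_iff₀' hpos, ← mul_assoc] at this
  exact this

lemma summable_coeff_weight (φ : SchwartzPhase n) (j M : ℕ) :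
    Summable fun z : Lattice n × Lattice n =>
      (1 + ‖z.1‖) ^ j * (1 + ‖z.2‖) ^ M * ‖coeff φ z‖ := by
  obtain ⟨C, hC⟩ := coeff_decay φ (2 * n + j) (2 * n + M)
  refine summable_of_one_add_norm_pow_mul_le (C := C) (fun z => by positivity) fun a b => ?_
  calc _ = (1 + ‖a‖) ^ (2 * n + j) * (1 + ‖b‖) ^ (2 * n + M) * ‖coeff φ (a, b)‖ := by
        rw [pow_add, pow_add]; ring
    _ ≤ C := hC a b

lemma summable_norm_coeff (φ : SchwartzPhase n) : Summable fun z => ‖coeff φ z‖ := by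
  simpa using summable_coeff_weight φ 0 0

/-- At a point over `a` only the monomials supported on `a` survive, leaving the absolutely
convergent Fourier series of one smooth slice. -/
lemma hasSum_coeff_mul_monomial_apply (φ : SchwartzPhase n) (p : Phase n) :
    HasSum (fun z => coeff φ z * monomial z p) (φ p) := by
  obtain ⟨a, w⟩ := p
  have hinj : Function.Injective fun b : Lattice n => (a, b) := fun b b' h => (Prod.ext_iff.1 h).2
  rw [← hinj.hasSum_iff]
  · have hs : Summable fun b : Lattice n => ‖coeff φ (a, b)‖ :=
      (summable_norm_coeff φ).prod_factor a
    have hco : ∀ b, coeff φ (a, b) = UnitAddTorus.mFourierCoeff (fun w => φ (a, w)) b := by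
      intro b
      refine integral_congr_ae (ae_of_all _ fun w => ?_)
      simp only [← character_neg]; rfl
    have := UnitAddTorus.hasSum_mFourier_series_apply_of_summable
      (f := ⟨fun w => φ (a, w), continuous_slice φ a⟩)
      ((hs.of_norm).congr fun b => (hco b)) w
    refine this.congr_fun fun b => ?_
    simp only [Function.comp_apply, monomial_apply, if_true, hco]
    rfl
  · rintro ⟨a', b⟩ h
    have : a ≠ a' := fun h' => h ⟨b, by simp [h']⟩
    simp [monomial_apply, this]

lemma sum_apply {κ : Type*} (s : Finset κ) (f : κ → SchwartzPhase n)
    (p : Phase n) : (∑ i ∈ s, f i) p = ∑ i ∈ s, f i p := by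
  have : ((schwartzPhaseSubmodule n).subtype (∑ i ∈ s, f i)) =
      ∑ i ∈ s, (schwartzPhaseSubmodule n).subtype (f i) :=
    map_sum (schwartzPhaseSubmodule n).subtype f s
  exact (congrFun this p).trans (Finset.sum_apply p s _)

/-- The Fourier expansion of a Schwartz function converges in the Schwartz space. -/
lemma hasSum_coeff_smul_monomial (φ : SchwartzPhase n) :
    HasSum (fun z => coeff φ z • monomial z) φ := by
  refine hasSum_of_seminorm_sub_le_tsum (withSeminorms n) fun q => ?_
  have hsum : ∀ j l : ℕ, Summable fun z : Lattice n × Lattice n =>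
      ‖coeff φ z‖ * ((1 + ‖z.1‖) ^ j * ((2 * Real.pi * n) ^ l * (1 + ‖z.2‖) ^ l)) := fun j l =>
    ((summable_coeff_weight φ j l).mul_left ((2 * Real.pi * n) ^ l)).congr fun z => by ring
  refine ⟨_, hsum q.1 q.2, fun s => ciSup_le fun y => ?_⟩
  obtain ⟨a, x⟩ := y
  dsimp only
  set f : Lattice n × Lattice n → (Fin n → ℝ) → ℂ := fun z x =>
    coeff φ z * lift (monomial z) a x with hf
  have hfsmul : ∀ z, f z = coeff φ z • lift (monomial z) a := fun z => rfl
  have hfs : ∀ z, ContDiff ℝ ∞ (f z) := fun z => by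
    rw [hfsmul]; exact contDiff_const.smul ((monomial z).2.1 a)
  have hfb : ∀ (j l : ℕ) z x, (1 + ‖a‖) ^ j * ‖iteratedFDeriv ℝ l (f z) x‖ ≤
      ‖coeff φ z‖ * ((1 + ‖z.1‖) ^ j * ((2 * Real.pi * n) ^ l * (1 + ‖z.2‖) ^ l)) := by
    intro j l z x
    rw [hfsmul, iteratedFDeriv_const_smul_apply
      (((monomial z).2.1 a).of_le (by exact_mod_cast le_top)).contDiffAt, norm_smul, mul_left_comm]
    exact mul_le_mul_of_nonneg_left (norm_iteratedFDeriv_lift_monomial_le z j l a x)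
      (norm_nonneg _)
  have hlift : lift φ a = fun x => ∑' z, f z x := by
    funext x
    exact (hasSum_coeff_mul_monomial_apply φ (a, toTorus x)).tsum_eq.symm
  have hsumlift : lift (∑ z ∈ s, coeff φ z • monomial z - φ : SchwartzPhase n) a =
      (∑ z ∈ s, f z) - lift φ a := by
    funext x
    have h1 : lift (∑ z ∈ s, coeff φ z • monomial z - φ : SchwartzPhase n) a x =
      (∑ z ∈ s, coeff φ z • monomial z : SchwartzPhase n) (a, toTorus x) - lift φ a x := rfl
    rw [h1, sum_apply, Pi.sub_apply, Finset.sum_apply]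
    rfl
  have hfb0 : ∀ (l : ℕ) z x, ‖iteratedFDeriv ℝ l (f z) x‖ ≤
      ‖coeff φ z‖ * ((1 + ‖z.1‖) ^ 0 * ((2 * Real.pi * n) ^ l * (1 + ‖z.2‖) ^ l)) := by
    intro l z x
    simpa only [pow_zero, one_mul] using hfb 0 l z x
  -- The derivatives of the terms have summable bounds uniform in `x`, so the Fourier series of the
  -- slice may be differentiated termwise.
  have hD : iteratedFDeriv ℝ q.2 (lift φ a) x = ∑' z, iteratedFDeriv ℝ q.2 (f z) x := by
    rw [hlift]
    exact iteratedFDeriv_tsum_apply (N := ⊤) (v := fun l z =>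
      ‖coeff φ z‖ * ((1 + ‖z.1‖) ^ 0 * ((2 * Real.pi * n) ^ l * (1 + ‖z.2‖) ^ l)))
      hfs (fun l _ => hsum 0 l) (fun l z x _ => hfb0 l z x) le_top x
  have hSD : Summable fun z => iteratedFDeriv ℝ q.2 (f z) x :=
    Summable.of_norm_bounded (hsum 0 q.2) fun z => hfb0 q.2 z x
  -- The derivative of the error is minus the tail of the differentiated series, which the same
  -- bounds control.
  have hcompl := (hSD.hasSum.summable.sum_add_tsum_subtype_compl s)
  rw [hsumlift, iteratedFDeriv_sub_apply, iteratedFDeriv_sum_apply, hD, ← hcompl,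
    sub_add_cancel_left, norm_neg]
  · have h1 : (1 + ‖a‖) ^ q.1 * ‖∑' z : {z // z ∉ s}, iteratedFDeriv ℝ q.2 (f z) x‖ =
        ‖∑' z : {z // z ∉ s}, (1 + ‖a‖) ^ q.1 • iteratedFDeriv ℝ q.2 (f z) x‖ := by
      rw [tsum_const_smul'', norm_smul, norm_pow, Real.norm_of_nonneg (by positivity)]
    rw [h1]
    refine tsum_of_norm_bounded ((hsum q.1 q.2).subtype _).hasSum fun z => ?_
    rw [norm_smul, norm_pow, Real.norm_of_nonneg (by positivity)]
    exact hfb q.1 q.2 z x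
  · exact fun z _ => ((hfs z).of_le (by exact_mod_cast le_top)).contDiffAt
  · rw [Finset.sum_fn]
    exact (ContDiff.sum fun z _ => (hfs z).of_le (by exact_mod_cast le_top)).contDiffAt
  · exact ((φ.2.1 a).of_le (by exact_mod_cast le_top)).contDiffAt

end SchwartzPhase

/-! ### Coefficients of short-time Fourier transforms -/

/-- Jensen's inequality, read off from the monotonicity of `L^q` norms in `q` on a probability
space. -/
lemma lintegral_rpow_le_lintegral_rpow {X : Type*} [MeasurableSpace X] {P : Measure X}
    [IsProbabilityMeasure P] {f : X → ℝ≥0∞} (hf : AEMeasurable f P) {q : ℝ} (hq : 1 ≤ q) :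
    (∫⁻ x, f x ∂P) ^ q ≤ ∫⁻ x, f x ^ q ∂P := by
  have h := eLpNorm_le_eLpNorm_of_exponent_le (μ := P) (f := f) (p := 1) (q := ENNReal.ofReal q)
    (by simpa using ENNReal.ofReal_le_ofReal hq) hf.aestronglyMeasurable
  rw [eLpNorm_one_eq_lintegral_enorm, eLpNorm_eq_lintegral_rpow_enorm_toReal
    (by simp; linarith) (by simp), ENNReal.toReal_ofReal (by linarith)] at h
  simp only [enorm_eq_self] at h
  have h' := ENNReal.rpow_le_rpow h (show 0 ≤ q by linarith)
  rwa [← ENNReal.rpow_mul, one_div, inv_mul_cancel₀ (by linarith), ENNReal.rpow_one] at h'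

lemma memℓp_of_tsum_enorm_rpow_ne_top {ι : Type*} {f : ι → ℂ} {p : ℝ≥0∞} (hp : 0 < p.toReal)
    (h : ∑' i, ‖f i‖ₑ ^ p.toReal ≠ ⊤) : Memℓp f p := by
  rw [memℓp_gen_iff hp]
  refine (ENNReal.summable_toReal h).congr fun i => ?_
  rw [← ENNReal.toReal_rpow, toReal_enorm]

/-- A coefficient in an expansion along unimodular, pairwise orthogonal functions is bounded by the
`L¹`-norm of the sum. -/
lemma enorm_coeff_le_lintegral_enorm {X κ : Type*} [MeasurableSpace X] [Nonempty X] [Countable κ]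
    {P : Measure X} [IsProbabilityMeasure P] {e : κ → X → ℂ} (hem : ∀ k, Measurable (e k))
    (hen : ∀ k x, ‖e k x‖ = 1) (heo : ∀ k l, k ≠ l → ∫ x, e k x * conj (e l x) ∂P = 0)
    {c : κ → ℂ} {V : X → ℂ} (hV : ∀ x, HasSum (fun k => conj (e k x) * c k) (V x)) (k : κ) :
    ‖c k‖ₑ ≤ ∫⁻ x, ‖V x‖ₑ ∂P := by
  -- Evaluation at a single point suffices: the functions are unimodular, and unconditional
  -- convergence in `ℂ` is absolute.
  have hc : Summable fun k => ‖c k‖ := by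
    refine (hV (Classical.arbitrary X)).summable.norm.congr fun k => ?_
    rw [norm_mul, RCLike.norm_conj, hen, one_mul]
  have hme : ∀ l, Measurable fun x => conj (e l x) := fun l =>
    Complex.continuous_conj.measurable.comp (hem l)
  have hn : ∀ l x, ‖e k x * (conj (e l x) * c l)‖ = ‖c l‖ := fun l x => by
    rw [norm_mul, norm_mul, RCLike.norm_conj, hen, hen, one_mul, one_mul]
  have hint : ∀ l, Integrable (fun x => e k x * (conj (e l x) * c l)) P := fun l =>
    Integrable.of_bound ((hem k).mul ((hme l).mul_const _)).aestronglyMeasurable ‖c l‖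
      (ae_of_all _ fun x => (hn l x).le)
  -- Multiply the series by `e k` and integrate termwise; orthogonality leaves only `c k`.
  have hs := hasSum_integral_of_summable_integral_norm hint
    (by simpa only [hn, integral_const, probReal_univ, one_smul] using hc)
  have h1 : ∀ x, ∑' l, e k x * (conj (e l x) * c l) = e k x * V x := fun x =>
    ((hV x).mul_left _).tsum_eq
  simp_rw [h1] at hs
  have h2 : ∀ l, l ≠ k → ∫ x, e k x * (conj (e l x) * c l) ∂P = 0 := fun l hl => by
    simp_rw [← mul_assoc]
    rw [integral_mul_const, heo k l hl.symm, zero_mul]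
  have h3 : ∫ x, e k x * (conj (e k x) * c k) ∂P = c k := by
    have : ∀ x, e k x * (conj (e k x) * c k) = c k := fun x => by
      rw [← mul_assoc, Complex.mul_conj, Complex.normSq_eq_norm_sq, hen]; simp
    simp [this]
  have h4 := hs.unique (hasSum_single k h2)
  rw [h3] at h4
  rw [← h4]
  refine (enorm_integral_le_lintegral_enorm _).trans (lintegral_mono fun x => ?_)
  rw [enorm_mul, ← ofReal_norm (e k x), hen]
  simp

lemma measurable_of_forall_hasSum {X κ : Type*} [MeasurableSpace X] [Countable κ]
    {f : κ → X → ℂ} {V : X → ℂ} (hf : ∀ k, Measurable (f k))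
    (hV : ∀ x, HasSum (fun k => f k x) (V x)) : Measurable V := by
  refine measurable_of_tendsto_metrizable' (atTop : Filter (Finset κ))
    (f := fun s x => ∑ k ∈ s, f k x) (fun s => Finset.measurable_fun_sum s fun k _ => hf k) ?_
  rw [tendsto_pi_nhds]
  exact hV

lemma integral_character_mul_conj {n : ℕ} {k l : Lattice n} (h : k ≠ l) :
    ∫ w, character k w * conj (character l w) ∂torusMeasure n = 0 := by
  simp_rw [← character_sub]
  rw [integral_character, if_neg (sub_ne_zero.2 h)]

/-- The distribution is applied termwise to the delta expansion of the shifted window. For fixed `m`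
the result is a Fourier series in `w`. -/
lemma hasSum_stft {n : ℕ} (γ : SchwartzLattice n) (u : TemperedLattice n) (m : Lattice n)
    (w : Torus n) :
    HasSum (fun k => conj (character k w) * (conj (γ (k - m)) * u.toFun k))
      (stft γ u (m, w)) := by
  have := u.hasSum (SchwartzLattice.hasSum_delta
    (SchwartzLattice.timeFreqShift m w γ).conjugate)
  refine this.congr_fun fun k => ?_
  rw [map_smul, smul_eq_mul, ← mul_assoc, ← map_mul]
  rfl

lemma measurable_stft_slice {n : ℕ} (γ : SchwartzLattice n) (u : TemperedLattice n)
    (m : Lattice n) : Measurable fun w => stft γ u (m, w) :=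
  measurable_of_forall_hasSum (fun k => (Complex.continuous_conj.comp
    (continuous_character k)).measurable.mul_const _) (hasSum_stft γ u m)

lemma measurable_stft {n : ℕ} (γ : SchwartzLattice n) (u : TemperedLattice n) :
    Measurable (stft γ u) :=
  measurable_from_prod_countable_right (measurable_stft_slice γ u)

/-- Taking the coefficient at `m + k` in the slice over `m` freezes the window factor at `γ k`. With
`k` fixed and `γ k ≠ 0`, varying `m` then reaches every value of `u`. -/
lemma enorm_mul_toFun_le_lintegral_stft {n : ℕ} (γ : SchwartzLattice n) (u : TemperedLattice n)
    (m k : Lattice n) :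
    ‖γ k‖ₑ * ‖u.toFun (m + k)‖ₑ ≤ ∫⁻ w, ‖stft γ u (m, w)‖ₑ ∂torusMeasure n := by
  have := enorm_coeff_le_lintegral_enorm (P := torusMeasure n) (e := character)
    (fun k => (continuous_character k).measurable) norm_character
    (fun k l h => integral_character_mul_conj h) (hasSum_stft γ u m) (m + k)
  rwa [add_sub_cancel_left, enorm_mul, ← ofReal_norm (conj (γ k)), RCLike.norm_conj,
    ofReal_norm] at this

lemma lintegral_phaseMeasure {n : ℕ} {f : Phase n → ℝ≥0∞} (hf : Measurable f) :
    ∫⁻ z, f z ∂phaseMeasure n = ∑' m, ∫⁻ w, f (m, w) ∂torusMeasure n := by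
  rw [phaseMeasure, lintegral_prod _ hf.aemeasurable, lintegral_count]

/-! ### Orlicz modulation spaces embed into `ℓ²` -/

/-- Slice integrals of the `L²` part are square summable by Jensen; those of the `L¹` part are
summable, hence square summable. -/
lemma lintegral_sum_rpow_two_lt_top {n : ℕ} {f g : Phase n → ℝ≥0∞} (hf : Measurable f)
    (hg : Measurable g) (hf2 : ∫⁻ z, f z ^ (2 : ℝ) ∂phaseMeasure n < ⊤)
    (hg1 : ∫⁻ z, g z ∂phaseMeasure n < ⊤) :
    ∑' m, (∫⁻ w, (f (m, w) + g (m, w)) ∂torusMeasure n) ^ (2 : ℝ) < ⊤ := by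
  have hfm : ∀ m, Measurable fun w => f (m, w) := fun m => hf.comp measurable_prodMk_left
  rw [lintegral_phaseMeasure (hf.pow_const _)] at hf2
  rw [lintegral_phaseMeasure hg] at hg1
  set F := fun m => ∫⁻ w, f (m, w) ∂torusMeasure n
  set B := fun m => ∫⁻ w, g (m, w) ∂torusMeasure n with hB
  have hF : ∑' m, F m ^ (2 : ℝ) < ⊤ := (ENNReal.tsum_le_tsum fun m =>
    lintegral_rpow_le_lintegral_rpow (hfm m).aemeasurable (by norm_num)).trans_lt hf2
  have hB2 : ∑' m, B m ^ (2 : ℝ) < ⊤ := by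
    calc ∑' m, B m ^ (2 : ℝ) ≤ ∑' m, (∑' m, B m) * B m := by
          refine ENNReal.tsum_le_tsum fun m => ?_
          rw [ENNReal.rpow_two, sq]
          gcongr
          exact ENNReal.le_tsum m
      _ = (∑' m, B m) * ∑' m, B m := ENNReal.tsum_mul_left
      _ < ⊤ := ENNReal.mul_lt_top hg1 hg1
  calc ∑' m, (∫⁻ w, (f (m, w) + g (m, w)) ∂torusMeasure n) ^ (2 : ℝ)
      ≤ ∑' m, (2 : ℝ≥0∞) ^ (2 - 1 : ℝ) * (F m ^ (2 : ℝ) + B m ^ (2 : ℝ)) := by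
        refine ENNReal.tsum_le_tsum fun m => ?_
        rw [lintegral_add_left (hfm m)]
        exact ENNReal.rpow_add_le_mul_rpow_add_rpow _ _ (by norm_num)
    _ = (2 : ℝ≥0∞) ^ (2 - 1 : ℝ) * (∑' m, F m ^ (2 : ℝ) + ∑' m, B m ^ (2 : ℝ)) := by
        rw [ENNReal.tsum_mul_left, ENNReal.tsum_add]
    _ < ⊤ := ENNReal.mul_lt_top (ENNReal.rpow_lt_top_of_nonneg (by norm_num) (by norm_num))
        (ENNReal.add_lt_top.2 ⟨hF, hB2⟩)

/-! ### Comparison of the Young function with `x²` and `x` -/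

section Young

variable {Φ : ℝ≥0∞ → ℝ≥0∞}

/-- On this range `-log x ≥ 3/2 ≥ 1`, so the logarithm only helps. -/
lemma ofReal_sq_le_of_eq_neg_sq_mul_log
    (hΦlog : ∀ x : ℝ, 0 ≤ x → x ≤ Real.exp (-(3 / 2)) →
      Φ (ENNReal.ofReal x) = ENNReal.ofReal (-(x ^ 2 * Real.log x)))
    {x : ℝ} (hx0 : 0 ≤ x) (hx : x ≤ Real.exp (-(3 / 2))) :
    ENNReal.ofReal (x ^ 2) ≤ Φ (ENNReal.ofReal x) := by
  rw [hΦlog x hx0 hx]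
  refine ENNReal.ofReal_le_ofReal ?_
  rcases hx0.eq_or_lt with rfl | hpos
  · simp
  · have : Real.log x ≤ -(3 / 2) := by
      rw [← Real.log_exp (-(3 / 2))]; exact Real.log_le_log hpos hx
    nlinarith [sq_nonneg x]

/-- A Young function grows at least linearly. -/
lemma IsYoungFunction.le_div_mul (hΦ : IsYoungFunction Φ) {x y : ℝ≥0} (hxy : x ≤ y)
    (hy : y ≠ 0) : Φ x ≤ (x / y : ℝ≥0) * Φ y := by
  have h1 : x / y ≤ 1 := div_le_one_of_le₀ hxy zero_le
  have := hΦ.convex (x / y) (1 - x / y) y 0 (add_tsub_cancel_of_le h1)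
  rwa [mul_zero, add_zero, div_mul_cancel₀ x hy, ENNReal.coe_zero, hΦ.map_zero, mul_zero,
    add_zero] at this

/-- Convexity and `Φ 0 = 0` make `Φ(x)/x` nondecreasing. At `a = e^{-3/2}` this quotient is at least
`a`, whence the constant `1/a = e^{3/2}`. -/
lemma ofReal_le_mul_of_eq_neg_sq_mul_log (hΦ : IsYoungFunction Φ)
    (hΦlog : ∀ x : ℝ, 0 ≤ x → x ≤ Real.exp (-(3 / 2)) →
      Φ (ENNReal.ofReal x) = ENNReal.ofReal (-(x ^ 2 * Real.log x)))
    {x : ℝ} (hx : Real.exp (-(3 / 2)) ≤ x) :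
    ENNReal.ofReal x ≤ ENNReal.ofReal (Real.exp (3 / 2)) * Φ (ENNReal.ofReal x) := by
  set a := Real.exp (-(3 / 2)) with ha
  have ha0 : 0 < a := Real.exp_pos _
  have hx0 : 0 < x := ha0.trans_le hx
  have hae : Real.exp (3 / 2) * a = 1 := by rw [ha, ← Real.exp_add]; simp
  have h1 := ofReal_sq_le_of_eq_neg_sq_mul_log hΦlog ha0.le le_rfl
  have h2 := hΦ.le_div_mul (x := a.toNNReal) (y := x.toNNReal) (Real.toNNReal_le_toNNReal hx)
    (by simpa using hx0)
  have h3 : ENNReal.ofReal (a ^ 2) ≤ ENNReal.ofReal (a / x) * Φ (ENNReal.ofReal x) := by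
    refine h1.trans (h2.trans (le_of_eq ?_))
    congr 1
    rw [← Real.toNNReal_div ha0.le]; rfl
  have h4 : ENNReal.ofReal x = ENNReal.ofReal (x * Real.exp (3 / 2) ^ 2) *
      ENNReal.ofReal (a ^ 2) := by
    rw [← ENNReal.ofReal_mul (by positivity), mul_assoc, ← mul_pow, hae, one_pow, mul_one]
  calc ENNReal.ofReal x = _ := h4
    _ ≤ ENNReal.ofReal (x * Real.exp (3 / 2) ^ 2) *
        (ENNReal.ofReal (a / x) * Φ (ENNReal.ofReal x)) := by gcongr
    _ = ENNReal.ofReal (x * Real.exp (3 / 2) ^ 2 * (a / x)) * Φ (ENNReal.ofReal x) := by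
        rw [← mul_assoc, ← ENNReal.ofReal_mul (by positivity)]
    _ = _ := by
        congr 2
        have : x * Real.exp (3 / 2) ^ 2 * (a / x) = Real.exp (3 / 2) * (Real.exp (3 / 2) * a) := by
          field_simp
        rw [this, hae, mul_one]

/-- Cut `h` at height `e^{-3/2}`: the low part is square integrable and the high part is integrable.
-/
lemma tsum_lintegral_rpow_two_lt_top_of_young {n : ℕ} (hΦ : IsYoungFunction Φ)
    (hΦlog : ∀ x : ℝ, 0 ≤ x → x ≤ Real.exp (-(3 / 2)) →
      Φ (ENNReal.ofReal x) = ENNReal.ofReal (-(x ^ 2 * Real.log x)))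
    {h : Phase n → ℝ≥0∞} (hm : Measurable h) (ht : ∀ z, h z ≠ ⊤)
    (hi : ∫⁻ z, Φ (h z) ∂phaseMeasure n < ⊤) :
    ∑' m, (∫⁻ w, h (m, w) ∂torusMeasure n) ^ (2 : ℝ) < ⊤ := by
  set s : Set (Phase n) := {z | h z ≤ ENNReal.ofReal (Real.exp (-(3 / 2)))} with hs
  have hsm : MeasurableSet s := measurableSet_le hm measurable_const
  have key := lintegral_sum_rpow_two_lt_top (f := s.indicator h) (g := sᶜ.indicator h)
    (hm.indicator hsm) (hm.indicator hsm.compl) ?_ ?_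
  · refine lt_of_eq_of_lt (tsum_congr fun m => ?_) key
    congr 1
    refine lintegral_congr fun w => ?_
    exact (congrFun (Set.indicator_self_add_compl s h) (m, w)).symm
  · refine (lintegral_mono fun z => ?_).trans_lt hi
    by_cases hz : z ∈ s
    · rw [Set.indicator_of_mem hz, ENNReal.rpow_two]
      have h1 : (h z).toReal ≤ Real.exp (-(3 / 2)) :=
        ENNReal.toReal_le_of_le_ofReal (Real.exp_pos _).le hz
      have := ofReal_sq_le_of_eq_neg_sq_mul_log hΦlog ENNReal.toReal_nonneg h1
      rwa [ENNReal.ofReal_pow ENNReal.toReal_nonneg, ENNReal.ofReal_toReal (ht z)] at this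
    · rw [Set.indicator_of_notMem hz]
      simp
  · refine (lintegral_mono (g := fun z => ENNReal.ofReal (Real.exp (3 / 2)) * Φ (h z))
      fun z => ?_).trans_lt ?_
    · by_cases hz : z ∈ s
      · rw [Set.indicator_of_notMem (by simpa using hz)]
        exact zero_le
      · rw [Set.indicator_of_mem (by simpa using hz)]
        have h1 : Real.exp (-(3 / 2)) ≤ (h z).toReal :=
          (ENNReal.ofReal_le_iff_le_toReal (ht z)).1 (not_le.1 hz).le
        have := ofReal_le_mul_of_eq_neg_sq_mul_log hΦ hΦlog h1
        rwa [ENNReal.ofReal_toReal (ht z)] at this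
    · rw [lintegral_const_mul' _ _ ENNReal.ofReal_ne_top]
      exact ENNReal.mul_lt_top ENNReal.ofReal_lt_top hi

lemma MemOrliczModulation.memℓp_two {n : ℕ} {γ : SchwartzLattice n} (hγ : γ ≠ 0)
    (hΦ : IsYoungFunction Φ)
    (hΦlog : ∀ x : ℝ, 0 ≤ x → x ≤ Real.exp (-(3 / 2)) →
      Φ (ENNReal.ofReal x) = ENNReal.ofReal (-(x ^ 2 * Real.log x)))
    {u : TemperedLattice n} (hu : MemOrliczModulation γ Φ u) : Memℓp u.toFun 2 := by
  obtain ⟨k, hk⟩ : ∃ k, γ k ≠ 0 := by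
    by_contra! h
    exact hγ (Subtype.ext (funext h))
  obtain ⟨_, ⟨b, ⟨hb, hb1⟩, rfl⟩, -⟩ := sInf_lt_iff.1 hu.2
  have hb0 : ENNReal.ofReal b ≠ 0 := by simpa using hb
  have key := tsum_lintegral_rpow_two_lt_top_of_young hΦ hΦlog
    (h := fun z => ‖stft γ u z‖ₑ / ENNReal.ofReal b) ((measurable_stft γ u).enorm.div_const _)
    (fun z => ENNReal.div_ne_top enorm_ne_top hb0) (hb1.trans_lt ENNReal.one_lt_top)
  set c : ℝ≥0∞ := ‖γ k‖ₑ / ENNReal.ofReal b with hc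
  have hc0 : c ≠ 0 := by
    rw [hc, Ne, ENNReal.div_eq_zero_iff, not_or]
    exact ⟨by simpa using hk, ENNReal.ofReal_ne_top⟩
  have h1 : ∑' m, c ^ (2 : ℝ) * ‖u.toFun (m + k)‖ₑ ^ (2 : ℝ) < ⊤ := by
    refine lt_of_le_of_lt (ENNReal.tsum_le_tsum fun m => ?_) key
    rw [← ENNReal.mul_rpow_of_nonneg _ _ (by norm_num)]
    refine ENNReal.rpow_le_rpow ?_ (by norm_num)
    simp_rw [div_eq_mul_inv]
    rw [lintegral_mul_const _ (measurable_stft_slice γ u m).enorm, hc, div_eq_mul_inv,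
      mul_right_comm]
    gcongr
    exact enorm_mul_toFun_le_lintegral_stft γ u m k
  have h3 := (Equiv.addRight k).tsum_eq fun m => ‖u.toFun m‖ₑ ^ (2 : ℝ)
  simp only [Equiv.coe_addRight] at h3
  rw [ENNReal.tsum_mul_left, h3] at h1
  refine memℓp_of_tsum_enorm_rpow_ne_top (by simp) fun htop => ?_
  have h2 : ∑' m, ‖u.toFun m‖ₑ ^ (2 : ℝ) = ⊤ := by simpa using htop
  rw [h2, ENNReal.mul_top] at h1
  · exact lt_irrefl _ h1
  · simpa [ENNReal.rpow_eq_zero_iff] using fun h => absurd h hc0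

end Young

/-! ### Modulation spaces on the phase space embed into `L²` -/

/-- On the Fourier side, `m` and `k` shift the indices and `θ`, `ξ` contribute only phases;
conjugation reflects the torus frequency, hence the minus sign. -/
lemma coeff_conjugate_modulate_translate {n : ℕ} (G : SchwartzPhase n) (m : Lattice n)
    (θ ξ : Torus n) (k a b : Lattice n) :
    SchwartzPhase.coeff
        (SchwartzPhase.modulate (ξ, k) (SchwartzPhase.translate (m, θ) G)).conjugate (a, b) =
      conj (character a ξ * character (b + k) θ) *
        conj (SchwartzPhase.coeff G (a - m, -(b + k))) := by
  have h1 := torusCoeff_translate (fun η => G (a - m, η)) (-(b + k)) (-θ)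
  rw [character_neg, character_neg_right, Complex.conj_conj] at h1
  have h2 : SchwartzPhase.coeff
      (SchwartzPhase.modulate (ξ, k) (SchwartzPhase.translate (m, θ) G)).conjugate (a, b) =
      conj (character a ξ * torusCoeff (fun η => G (a - m, η + -θ)) (-(b + k))) := by
    unfold SchwartzPhase.coeff torusCoeff
    rw [← integral_const_mul, ← integral_conj]
    refine integral_congr_ae (ae_of_all _ fun η => ?_)
    change conj (character b η) * conj (character a ξ * character k η * G (a - m, η - θ)) = _
    dsimp only
    rw [character_neg, Complex.conj_conj, character_add, ← map_mul, sub_eq_add_neg η θ]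
    congr 1
    ring
  rw [h2, h1, ← map_mul]
  congr 1
  simp only [SchwartzPhase.coeff]
  ring

/-- For fixed lattice variables `m` and `k` this is a Fourier series in the two torus variables,
which puts the phase-space transform within reach of `enorm_coeff_le_lintegral_enorm`. -/
lemma hasSum_stftPhase {n : ℕ} (G : SchwartzPhase n) (U : TemperedPhase n) (m : Lattice n)
    (θ ξ : Torus n) (k : Lattice n) :
    HasSum (fun z : Lattice n × Lattice n => conj (character z.1 ξ * character (z.2 + k) θ) *
        (conj (SchwartzPhase.coeff G (z.1 - m, -(z.2 + k))) * U (SchwartzPhase.monomial z)))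
      (stftPhase G U ((m, θ), (ξ, k))) := by
  have := U.hasSum (SchwartzPhase.hasSum_coeff_smul_monomial
    (SchwartzPhase.modulate (ξ, k) (SchwartzPhase.translate (m, θ) G)).conjugate)
  refine this.congr_fun fun z => ?_
  rw [map_smul, smul_eq_mul, coeff_conjugate_modulate_translate, mul_assoc]

lemma measurable_character_uncurry {n : ℕ} (b : Lattice n) :
    Measurable fun q : Lattice n × Torus n => character (b + q.1) q.2 :=
  measurable_from_prod_countable_right fun k => (continuous_character (b + k)).measurable

lemma measurable_stftPhase {n : ℕ} (G : SchwartzPhase n) (U : TemperedPhase n) :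
    Measurable (stftPhase G U) := by
  have hconj : Measurable (conj : ℂ → ℂ) := Complex.continuous_conj.measurable
  have key : ∀ q : Phase n × (Torus n × Lattice n), HasSum (fun z : Lattice n × Lattice n =>
      conj (character z.1 q.2.1 * character (z.2 + q.2.2) q.1.2) *
        (conj (SchwartzPhase.coeff G (z.1 - q.1.1, -(z.2 + q.2.2))) *
          U (SchwartzPhase.monomial z))) (stftPhase G U q) := by
    rintro ⟨⟨m, θ⟩, ξ, k⟩
    exact hasSum_stftPhase G U m θ ξ k
  refine measurable_of_forall_hasSum (fun z => ?_) key
  have h1 := (continuous_character z.1).measurable.comp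
    (by fun_prop : Measurable fun q : Phase n × (Torus n × Lattice n) => q.2.1)
  have h2 := (measurable_character_uncurry z.2).comp
    (by fun_prop : Measurable fun q : Phase n × (Torus n × Lattice n) => (q.2.2, q.1.2))
  have h3 := (measurable_of_countable fun q : Lattice n × Lattice n =>
      SchwartzPhase.coeff G (z.1 - q.1, -(z.2 + q.2))).comp
    (by fun_prop : Measurable fun q : Phase n × (Torus n × Lattice n) => (q.1.1, q.2.2))
  have h4 := (hconj.comp (h1.mul h2)).mul ((hconj.comp h3).mul_const (U (SchwartzPhase.monomial z)))
  exact h4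

lemma enorm_mul_monomial_le_lintegral_stftPhase {n : ℕ} (G : SchwartzPhase n)
    (U : TemperedPhase n) (m k a b : Lattice n) :
    ‖SchwartzPhase.coeff G (a, b)‖ₑ * ‖U (SchwartzPhase.monomial (m + a, -k - b))‖ₑ ≤
      ∫⁻ q : Torus n × Torus n, ‖stftPhase G U ((m, q.1), (q.2, k))‖ₑ
        ∂(torusMeasure n).prod (torusMeasure n) := by
  have := enorm_coeff_le_lintegral_enorm (P := (torusMeasure n).prod (torusMeasure n))
    (e := fun (z : Lattice n × Lattice n) (q : Torus n × Torus n) =>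
      character z.1 q.2 * character (z.2 + k) q.1)
    (fun z => ((continuous_character _).comp continuous_snd).measurable.mul
      ((continuous_character _).comp continuous_fst).measurable)
    (fun z q => by rw [norm_mul, norm_character, norm_character, one_mul])
    (fun z z' hz => by
      have h1 : ∀ q : Torus n × Torus n,
          character z.1 q.2 * character (z.2 + k) q.1 *
            conj (character z'.1 q.2 * character (z'.2 + k) q.1) =
          (character (z.2 + k) q.1 * conj (character (z'.2 + k) q.1)) *
            (character z.1 q.2 * conj (character z'.1 q.2)) := fun q => by
        rw [map_mul]; ring
      simp_rw [h1]
      rw [integral_prod_mul (fun w => character (z.2 + k) w * conj (character (z'.2 + k) w))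
        fun w => character z.1 w * conj (character z'.1 w)]
      -- The integral factors over the two tori, and distinct indices differ in at least one
      -- component.
      by_cases h2 : z.2 = z'.2
      · have h3 : z.1 ≠ z'.1 := fun h3 => hz (Prod.ext h3 h2)
        rw [integral_character_mul_conj h3, mul_zero]
      · rw [integral_character_mul_conj (fun h => h2 (add_right_cancel h)), zero_mul])
    (fun q => hasSum_stftPhase G U m q.1 q.2 k) (m + a, -k - b)
  -- The index `(m + a, -k - b)` is chosen so that the window coefficient is `coeff G (a, b)` for
  -- all `m` and `k`.
  have h4 : (m + a - m, -(-k - b + k)) = (a, b) := by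
    ext1
    · simp
    · simp
  rwa [enorm_mul, ← ofReal_norm (conj _), RCLike.norm_conj, ofReal_norm, h4] at this

lemma lintegral_phaseDualMeasure {n : ℕ} {f : Phase n × (Torus n × Lattice n) → ℝ≥0∞}
    (hf : Measurable f) :
    ∫⁻ z, f z ∂phaseDualMeasure n = ∑' z : Lattice n × Lattice n,
      ∫⁻ q : Torus n × Torus n, f ((z.1, q.1), (q.2, z.2))
        ∂(torusMeasure n).prod (torusMeasure n) := by
  rw [phaseDualMeasure, lintegral_prod _ hf.aemeasurable,
    lintegral_phaseMeasure hf.lintegral_prod_right', ENNReal.tsum_prod (f := fun m k =>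
      ∫⁻ q : Torus n × Torus n, f ((m, q.1), (q.2, k)) ∂(torusMeasure n).prod (torusMeasure n))]
  refine tsum_congr fun m => ?_
  have hm : ∀ k, Measurable fun q : Torus n × Torus n => f ((m, q.1), (q.2, k)) := fun k =>
    hf.comp (by fun_prop)
  rw [← lintegral_tsum fun k => (hm k).aemeasurable, lintegral_prod _
    (Measurable.tsum hm).aemeasurable]
  refine lintegral_congr fun θ => ?_
  have h2 : Measurable fun q => f ((m, θ), q) := hf.comp measurable_prodMk_left
  rw [lintegral_prod _ h2.aemeasurable]
  exact lintegral_congr fun ξ => lintegral_count _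

/-- Fix one nonzero Fourier coefficient of `G`. The coefficient bound and Jensen on `𝕋ⁿ × 𝕋ⁿ`
control the `ℓ^p` norm of the monomial values by the `L^p` norm of the transform, and `ℓ^p ⊂ ℓ²` for
`p ≤ 2`. -/
lemma MemModulationPhase.memℓp_two {n : ℕ} {G : SchwartzPhase n} (hG : G ≠ 0) {p : ℝ≥0∞}
    (hp₁ : 1 ≤ p) (hp₂ : p ≤ 2) {U : TemperedPhase n} (hU : MemModulationPhase G p U) :
    Memℓp (fun z => U (SchwartzPhase.monomial z)) 2 := by
  -- If all coefficients vanished, the pointwise Fourier expansion would force `G = 0`.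
  obtain ⟨⟨a, b⟩, hab⟩ : ∃ z, SchwartzPhase.coeff G z ≠ 0 := by
    by_contra! h
    refine hG (Subtype.ext (funext fun q =>
      (SchwartzPhase.hasSum_coeff_mul_monomial_apply G q).unique ?_))
    simp only [h, zero_mul]
    exact hasSum_zero
  have hpt : p ≠ ⊤ := ne_top_of_le_ne_top (by simp) hp₂
  have hp0 : p ≠ 0 := (zero_lt_one.trans_le hp₁).ne'
  have hq : 1 ≤ p.toReal := by
    simpa using ENNReal.toReal_mono hpt hp₁
  have hq0 : 0 < p.toReal := by linarith
  have hlt := lintegral_rpow_enorm_lt_top_of_eLpNorm_lt_top hp0 hpt hU.2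
  have hVm := measurable_stftPhase G U
  rw [lintegral_phaseDualMeasure (hVm.enorm.pow_const _)] at hlt
  set c := ‖SchwartzPhase.coeff G (a, b)‖ₑ
  have h1 : ∑' z : Lattice n × Lattice n,
      c ^ p.toReal * ‖U (SchwartzPhase.monomial (z.1 + a, -z.2 - b))‖ₑ ^ p.toReal < ⊤ := by
    refine lt_of_le_of_lt (ENNReal.tsum_le_tsum fun z => ?_) hlt
    rw [← ENNReal.mul_rpow_of_nonneg _ _ hq0.le]
    refine (ENNReal.rpow_le_rpow
      (enorm_mul_monomial_le_lintegral_stftPhase G U z.1 z.2 a b) hq0.le).trans ?_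
    exact lintegral_rpow_le_lintegral_rpow
      (hVm.comp (by fun_prop : Measurable fun q : Torus n × Torus n =>
        ((z.1, q.1), (q.2, z.2)))).enorm.aemeasurable hq
  have h3 := ((Equiv.addRight a).prodCongr ((Equiv.neg _).trans (Equiv.subRight b))).tsum_eq
    fun z => ‖U (SchwartzPhase.monomial z)‖ₑ ^ p.toReal
  have h4 : ∑' z : Lattice n × Lattice n,
      ‖U (SchwartzPhase.monomial (z.1 + a, -z.2 - b))‖ₑ ^ p.toReal =
      ∑' z, ‖U (SchwartzPhase.monomial z)‖ₑ ^ p.toReal := h3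
  rw [ENNReal.tsum_mul_left, h4] at h1
  refine (memℓp_of_tsum_enorm_rpow_ne_top hq0 fun htop => ?_).of_exponent_ge hp₂
  rw [htop, ENNReal.mul_top] at h1
  · exact lt_irrefl _ h1
  · have hc : c ≠ 0 := by simpa [c] using hab
    exact (ENNReal.rpow_pos (pos_iff_ne_zero.2 hc) enorm_ne_top).ne'

/-! ### Square-integrable symbols with prescribed Fourier coefficients -/

lemma lintegral_enorm_rpow_two_ne_top_of_memLp {X : Type*} [MeasurableSpace X] {μ : Measure X}
    {f : X → ℂ} (hf : MemLp f 2 μ) : ∫⁻ x, ‖f x‖ₑ ^ (2 : ℝ) ∂μ ≠ ⊤ := by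
  simpa using (lintegral_rpow_enorm_lt_top_of_eLpNorm_lt_top (by simp) (by simp) hf.2).ne

lemma memLp_two_of_lintegral_ne_top {X : Type*} [MeasurableSpace X] {μ : Measure X}
    {f : X → ℂ} (hf : Measurable f) (h : ∫⁻ x, ‖f x‖ₑ ^ (2 : ℝ) ∂μ ≠ ⊤) : MemLp f 2 μ := by
  refine ⟨hf.aestronglyMeasurable, ?_⟩
  rw [eLpNorm_eq_lintegral_rpow_enorm_toReal (by simp) (by simp)]
  exact ENNReal.rpow_lt_top_of_nonneg (by simp) (by simpa using h)

/-- Riesz–Fischer together with Parseval. -/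
lemma exists_torusCoeff_eq {n : ℕ} {c : Lattice n → ℂ} (hc : Memℓp c 2) :
    ∃ h : Torus n → ℂ, Measurable h ∧ (∀ b, torusCoeff h b = c b) ∧
      ∫⁻ w, ‖h w‖ₑ ^ (2 : ℝ) ∂torusMeasure n = ∑' b, ‖c b‖ₑ ^ (2 : ℝ) := by
  set f : Lp ℂ 2 (torusMeasure n) := UnitAddTorus.mFourierBasis.repr.symm ⟨c, hc⟩ with hf
  have hcoeff : ∀ b, UnitAddTorus.mFourierCoeff f b = c b := fun b => by
    have := UnitAddTorus.mFourierBasis_repr f b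
    rw [hf, LinearIsometryEquiv.apply_symm_apply] at this
    exact this.symm
  refine ⟨f, (Lp.stronglyMeasurable f).measurable, fun b => ?_, ?_⟩
  · rw [← hcoeff]
    refine integral_congr_ae (ae_of_all _ fun w => ?_)
    change conj (character b w) * f w = character (-b) w * f w
    rw [character_neg]
  · have h1 : HasSum (fun b => ‖c b‖ ^ 2) (∫ w, ‖f w‖ ^ 2 ∂torusMeasure n) := by
      exact HasSum.congr_fun (UnitAddTorus.hasSum_sq_mFourierCoeff f) fun b =>
        congrArg (fun z => ‖z‖ ^ 2) (hcoeff b).symm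
    have h2 : Integrable (fun w => ‖f w‖ ^ 2) (torusMeasure n) :=
      (memLp_two_iff_integrable_sq_norm (Lp.aestronglyMeasurable f)).1 (Lp.memLp f)
    have h3 : ∀ z : ℂ, ‖z‖ₑ ^ (2 : ℝ) = ENNReal.ofReal (‖z‖ ^ 2) := fun z => by
      rw [ENNReal.ofReal_pow (norm_nonneg _), ofReal_norm, ENNReal.rpow_two]
    rw [lintegral_congr fun w => h3 (f w), tsum_congr fun b => h3 (c b),
      ← ofReal_integral_eq_lintegral_ofReal h2 (ae_of_all _ fun w => by positivity),
      ← h1.tsum_eq, ENNReal.ofReal_tsum_of_nonneg (fun b => by positivity) h1.summable]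

lemma tsum_enorm_rpow_two_ne_top {ι : Type*} {c : ι → ℂ} (hc : Memℓp c 2) :
    ∑' i, ‖c i‖ₑ ^ (2 : ℝ) ≠ ⊤ := by
  have h := (memℓp_gen_iff (by simp)).1 hc
  have h3 : ∀ i, ‖c i‖ₑ ^ (2 : ℝ) = ENNReal.ofReal (‖c i‖ ^ (2 : ℝ)) := fun i => by
    rw [← ENNReal.ofReal_rpow_of_nonneg (norm_nonneg _) (by norm_num), ofReal_norm]
  simp_rw [h3]
  rw [← ENNReal.ofReal_tsum_of_nonneg (fun i => by positivity) (by simpa using h)]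
  exact ENNReal.ofReal_ne_top

lemma memℓp_two_of_tsum_ne_top {ι : Type*} {c : ι → ℂ} (h : ∑' i, ‖c i‖ₑ ^ (2 : ℝ) ≠ ⊤) :
    Memℓp c 2 :=
  memℓp_of_tsum_enorm_rpow_ne_top (by simp) (by simpa using h)

/-- Riesz–Fischer on each slice; joint measurability follows because the lattice is countable, and
the slice Parseval identities add up. -/
lemma exists_symbol_torusCoeff_eq {n : ℕ} {c : Lattice n × Lattice n → ℂ} (hc : Memℓp c 2) :
    ∃ σ : Phase n → ℂ, Measurable σ ∧ MemLp σ 2 (phaseMeasure n) ∧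
      ∀ a b, torusCoeff (fun w => σ (a, w)) b = c (a, b) := by
  have hsum := tsum_enorm_rpow_two_ne_top hc
  rw [ENNReal.tsum_prod (f := fun a b => ‖c (a, b)‖ₑ ^ (2 : ℝ))] at hsum
  have hslice : ∀ a, Memℓp (fun b => c (a, b)) 2 := fun a =>
    memℓp_two_of_tsum_ne_top (ENNReal.ne_top_of_tsum_ne_top hsum a)
  choose h hm hcoef hint using fun a => exists_torusCoeff_eq (hslice a)
  have hσ : Measurable fun z : Phase n => h z.1 z.2 := measurable_from_prod_countable_right hm
  refine ⟨fun z => h z.1 z.2, hσ, memLp_two_of_lintegral_ne_top hσ ?_, hcoef⟩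
  rw [lintegral_phaseMeasure (hσ.enorm.pow_const _)]
  simp only [hint]
  exact hsum

/-- Termwise integration of a pointwise convergent series. -/
lemma integrable_and_integral_eq_tsum_of_lintegral_ne_top {X κ : Type*} [MeasurableSpace X]
    [Countable κ] {μ : Measure X} {F : κ → X → ℂ} {V : X → ℂ} (hF : ∀ k, Measurable (F k))
    (hV : ∀ x, HasSum (fun k => F k x) (V x)) (h : ∑' k, ∫⁻ x, ‖F k x‖ₑ ∂μ ≠ ⊤) :
    Integrable V μ ∧ ∫ x, V x ∂μ = ∑' k, ∫ x, F k x ∂μ := by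
  refine ⟨⟨(measurable_of_forall_hasSum hF hV).aestronglyMeasurable, ?_⟩, ?_⟩
  · refine lt_of_le_of_lt (lintegral_mono (g := fun x => ∑' k, ‖F k x‖ₑ) fun x => ?_) ?_
    · rw [← (hV x).tsum_eq]
      exact enorm_tsum_le_tsum_enorm
    · rw [lintegral_tsum fun k => (hF k).enorm.aemeasurable]
      exact h.lt_top
  · rw [← integral_tsum (fun k => (hF k).aestronglyMeasurable) h]
    exact integral_congr_ae (ae_of_all _ fun x => (hV x).tsum_eq.symm)

lemma integral_phaseMeasure {n : ℕ} {f : Phase n → ℂ} (hf : Integrable f (phaseMeasure n)) :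
    ∫ z, f z ∂phaseMeasure n = ∑' m, ∫ w, f (m, w) ∂torusMeasure n := by
  rw [phaseMeasure, integral_prod _ hf, integral_countable hf.integral_prod_left]
  simp [Measure.real]

lemma measurable_monomial {n : ℕ} (z : Lattice n × Lattice n) :
    Measurable (SchwartzPhase.monomial z : Phase n → ℂ) := by
  refine measurable_from_prod_countable_right fun m => ?_
  simp only [SchwartzPhase.monomial_apply]
  split_ifs
  · exact (continuous_character _).measurable
  · exact measurable_const

lemma lintegral_enorm_mul_monomial {n : ℕ} {σ : Phase n → ℂ} (hσ : Measurable σ)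
    (z : Lattice n × Lattice n) :
    ∫⁻ p, ‖σ p * SchwartzPhase.monomial z p‖ₑ ∂phaseMeasure n =
      ∫⁻ w, ‖σ (z.1, w)‖ₑ ∂torusMeasure n := by
  rw [lintegral_phaseMeasure (f := fun p => ‖σ p * SchwartzPhase.monomial z p‖ₑ)
    (hσ.mul (measurable_monomial z)).enorm, tsum_eq_single z.1]
  · refine lintegral_congr fun w => ?_
    rw [SchwartzPhase.monomial_apply, if_pos rfl, enorm_mul, ← ofReal_norm (character _ _),
      norm_character, ENNReal.ofReal_one, mul_one]
  · intro m hm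
    simp [SchwartzPhase.monomial_apply, hm]

lemma lintegral_slice_rpow_two_le {n : ℕ} {σ : Phase n → ℂ} (hσ : Measurable σ) (a : Lattice n) :
    (∫⁻ w, ‖σ (a, w)‖ₑ ∂torusMeasure n) ^ (2 : ℝ) ≤ ∫⁻ p, ‖σ p‖ₑ ^ (2 : ℝ) ∂phaseMeasure n := by
  have hσa : Measurable fun w => σ (a, w) := hσ.comp measurable_prodMk_left
  refine (lintegral_rpow_le_lintegral_rpow hσa.enorm.aemeasurable (by norm_num)).trans ?_
  rw [lintegral_phaseMeasure (hσ.enorm.pow_const _)]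
  exact ENNReal.le_tsum (f := fun a => ∫⁻ w, ‖σ (a, w)‖ₑ ^ (2 : ℝ) ∂torusMeasure n) a

/-- The pairing carries no conjugate, so it reads the coefficient at the opposite frequency. -/
lemma integral_mul_monomial {n : ℕ} {σ : Phase n → ℂ} (hσ : Measurable σ)
    (hσ2 : MemLp σ 2 (phaseMeasure n)) (z : Lattice n × Lattice n) :
    ∫ p, σ p * SchwartzPhase.monomial z p ∂phaseMeasure n =
      torusCoeff (fun w => σ (z.1, w)) (-z.2) := by
  have hint : Integrable (fun p => σ p * SchwartzPhase.monomial z p) (phaseMeasure n) := by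
    refine ⟨(hσ.mul (measurable_monomial z)).aestronglyMeasurable, ?_⟩
    rw [HasFiniteIntegral, lintegral_enorm_mul_monomial hσ]
    by_contra! h
    have := (lintegral_slice_rpow_two_le hσ z.1).trans_lt
      (lintegral_enorm_rpow_two_ne_top_of_memLp hσ2).lt_top
    rw [top_le_iff.1 h] at this
    simp at this
  rw [integral_phaseMeasure hint, tsum_eq_single z.1]
  · refine integral_congr_ae (ae_of_all _ fun w => ?_)
    simp only [SchwartzPhase.monomial_apply, if_true, character_neg, Complex.conj_conj]
    ring
  · intro m hm
    simp [SchwartzPhase.monomial_apply, hm]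

/-- A distribution whose Fourier coefficients are those of a square-integrable function is that
function. -/
lemma isFunction_of_torusCoeff_eq {n : ℕ} {U : TemperedPhase n} {σ : Phase n → ℂ}
    (hσ : Measurable σ) (hσ2 : MemLp σ 2 (phaseMeasure n))
    (hc : ∀ a b, torusCoeff (fun w => σ (a, w)) b = U (SchwartzPhase.monomial (a, -b))) :
    U.IsFunction σ := by
  refine ⟨hσ.aestronglyMeasurable, fun φ => ?_⟩
  set S := ∫⁻ p, ‖σ p‖ₑ ^ (2 : ℝ) ∂phaseMeasure n
  have hS : S ≠ ⊤ := lintegral_enorm_rpow_two_ne_top_of_memLp hσ2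
  have hF : ∀ z, Measurable fun p => σ p * (SchwartzPhase.coeff φ z *
      SchwartzPhase.monomial z p) := fun z => hσ.mul ((measurable_monomial z).const_mul _)
  -- `S ^ (1 / 2)` is the `L²` norm of `σ`, which dominates the `L¹` norm of each slice. Summability
  -- of the coefficients of `φ` then justifies integrating the Fourier expansion termwise.
  have hle : ∀ z, ∫⁻ p, ‖σ p * (SchwartzPhase.coeff φ z * SchwartzPhase.monomial z p)‖ₑ
      ∂phaseMeasure n ≤ ‖SchwartzPhase.coeff φ z‖ₑ * S ^ (1 / 2 : ℝ) := by
    intro z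
    simp_rw [mul_left_comm (σ _)]
    simp_rw [enorm_mul (SchwartzPhase.coeff φ z)]
    rw [lintegral_const_mul' _ _ enorm_ne_top, lintegral_enorm_mul_monomial hσ]
    gcongr
    have := ENNReal.rpow_le_rpow (lintegral_slice_rpow_two_le hσ z.1)
      (by norm_num : (0 : ℝ) ≤ 1 / 2)
    rwa [← ENNReal.rpow_mul, mul_one_div_cancel (by norm_num), ENNReal.rpow_one] at this
  have hfin : ∑' z, ‖SchwartzPhase.coeff φ z‖ₑ ≠ ⊤ := by
    simp_rw [← ofReal_norm]
    rw [← ENNReal.ofReal_tsum_of_nonneg (fun z => norm_nonneg _)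
      (SchwartzPhase.summable_norm_coeff φ)]
    exact ENNReal.ofReal_ne_top
  obtain ⟨h1, h2⟩ := integrable_and_integral_eq_tsum_of_lintegral_ne_top hF
    (fun p => (SchwartzPhase.hasSum_coeff_mul_monomial_apply φ p).mul_left (σ p))
    (ne_top_of_le_ne_top (ENNReal.mul_ne_top hfin
      (ENNReal.rpow_ne_top_of_nonneg (by norm_num) hS))
      ((ENNReal.tsum_le_tsum hle).trans ENNReal.tsum_mul_right.le))
  refine ⟨h1, ?_⟩
  rw [h2, ← (U.hasSum (SchwartzPhase.hasSum_coeff_smul_monomial φ)).tsum_eq]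
  refine tsum_congr fun z => ?_
  simp_rw [mul_left_comm (σ _)]
  rw [integral_const_mul, integral_mul_monomial hσ hσ2, hc, neg_neg, map_smul, smul_eq_mul]

/-! ### Hilbert–Schmidt operators on `ℓ²` -/

lemma tsum_mul_rpow_two_le {ι : Type*} (a b : ι → ℝ≥0∞) :
    (∑' i, a i * b i) ^ (2 : ℝ) ≤ (∑' i, a i ^ (2 : ℝ)) * ∑' i, b i ^ (2 : ℝ) := by
  -- Cauchy–Schwarz for sums is Hölder for counting measure; the full σ-algebra makes every function
  -- measurable.
  let _ : MeasurableSpace ι := ⊤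
  have h := ENNReal.lintegral_mul_le_Lp_mul_Lq (Measure.count : Measure ι)
    Real.HolderConjugate.two_two (f := a) (g := b) (measurable_from_top).aemeasurable
    (measurable_from_top).aemeasurable
  simp only [Pi.mul_apply, lintegral_count] at h
  refine (ENNReal.rpow_le_rpow h (by norm_num)).trans_eq ?_
  rw [ENNReal.mul_rpow_of_nonneg _ _ (by norm_num), ← ENNReal.rpow_mul, ← ENNReal.rpow_mul]
  norm_num

lemma mul_le_rpow_two_add_rpow_two (a b : ℝ≥0∞) :
    a * b ≤ a ^ (2 : ℝ) + b ^ (2 : ℝ) := by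
  rw [ENNReal.rpow_two, ENNReal.rpow_two, sq, sq]
  rcases le_total a b with h | h
  · exact (mul_le_mul_left h b).trans le_add_self
  · exact (mul_le_mul_right h a).trans le_self_add

lemma tsum_enorm_mul_enorm_ne_top {ι : Type*} {a b : ι → ℂ} (ha : Memℓp a 2) (hb : Memℓp b 2) :
    ∑' i, ‖a i‖ₑ * ‖b i‖ₑ ≠ ⊤ := by
  refine ne_top_of_le_ne_top ?_
    (ENNReal.tsum_le_tsum fun i => mul_le_rpow_two_add_rpow_two _ _)
  rw [ENNReal.tsum_add]
  exact ENNReal.add_ne_top.2 ⟨tsum_enorm_rpow_two_ne_top ha, tsum_enorm_rpow_two_ne_top hb⟩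

lemma summable_of_tsum_enorm_ne_top {ι : Type*} {a : ι → ℂ} (h : ∑' i, ‖a i‖ₑ ≠ ⊤) :
    Summable a :=
  Summable.of_norm ((ENNReal.summable_toReal h).congr fun i => by rw [toReal_enorm])

lemma summable_mul_of_memℓp {ι : Type*} {a b : ι → ℂ} (ha : Memℓp a 2) (hb : Memℓp b 2) :
    Summable fun i => a i * b i :=
  summable_of_tsum_enorm_ne_top (by simpa only [enorm_mul] using tsum_enorm_mul_enorm_ne_top ha hb)

lemma lp_enorm_rpow_two {ι : Type*} (f : lp (fun _ : ι => ℂ) 2) :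
    ‖f‖ₑ ^ (2 : ℝ) = ∑' i, ‖f i‖ₑ ^ (2 : ℝ) := by
  have h := lp.norm_rpow_eq_tsum (p := 2) (by simp) f
  have hs := (memℓp_gen_iff (p := 2) (by simp)).1 (lp.memℓp f)
  simp only [ENNReal.toReal_ofNat] at h hs
  have h3 : ∀ i, ‖f i‖ₑ ^ (2 : ℝ) = ENNReal.ofReal (‖f i‖ ^ (2 : ℝ)) := fun i => by
    rw [← ENNReal.ofReal_rpow_of_nonneg (norm_nonneg _) (by norm_num), ofReal_norm]
  rw [tsum_congr h3, ← ENNReal.ofReal_tsum_of_nonneg (fun i => by positivity) hs, ← h,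
    ← ENNReal.ofReal_rpow_of_nonneg (norm_nonneg _) (by norm_num), ofReal_norm]

section HilbertSchmidt

variable {ι : Type*}

lemma memℓp_row {K : ι × ι → ℂ} (hK : Memℓp K 2) (k : ι) : Memℓp (fun l => K (k, l)) 2 := by
  have h := tsum_enorm_rpow_two_ne_top hK
  rw [ENNReal.tsum_prod (f := fun a b => ‖K (a, b)‖ₑ ^ (2 : ℝ))] at h
  exact memℓp_two_of_tsum_ne_top (ENNReal.ne_top_of_tsum_ne_top h k)

/-- Cauchy–Schwarz in each row: the Hilbert–Schmidt norm dominates the operator norm. -/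
lemma tsum_enorm_rpow_two_kernel_le (K : ι × ι → ℂ) (f : ι → ℂ) :
    ∑' k, ‖∑' l, K (k, l) * f l‖ₑ ^ (2 : ℝ) ≤
      (∑' z, ‖K z‖ₑ ^ (2 : ℝ)) * ∑' l, ‖f l‖ₑ ^ (2 : ℝ) := by
  rw [ENNReal.tsum_prod (f := fun a b => ‖K (a, b)‖ₑ ^ (2 : ℝ)), ← ENNReal.tsum_mul_right]
  refine ENNReal.tsum_le_tsum fun k => ?_
  refine (ENNReal.rpow_le_rpow (enorm_tsum_le_tsum_enorm (f := fun l => K (k, l) * f l))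
    (by norm_num)).trans ?_
  simp_rw [enorm_mul]
  exact tsum_mul_rpow_two_le _ _

/-- The operator with a square-summable kernel, as a bilinear map. -/
def kernelBilin (ι : Type*) :
    lp (fun _ : ι × ι => ℂ) 2 →ₗ[ℂ] lp (fun _ : ι => ℂ) 2 →ₗ[ℂ] lp (fun _ : ι => ℂ) 2 :=
  LinearMap.mk₂ ℂ
    (fun K f => ⟨fun k => ∑' l, K (k, l) * f l, memℓp_two_of_tsum_ne_top
      (ne_top_of_le_ne_top (ENNReal.mul_ne_top (tsum_enorm_rpow_two_ne_top (lp.memℓp K))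
        (tsum_enorm_rpow_two_ne_top (lp.memℓp f))) (tsum_enorm_rpow_two_kernel_le K f))⟩)
    (fun K K' f => by
      ext k
      have h := (summable_mul_of_memℓp (memℓp_row (lp.memℓp K) k) (lp.memℓp f)).tsum_add
        (summable_mul_of_memℓp (memℓp_row (lp.memℓp K') k) (lp.memℓp f))
      refine Eq.trans (tsum_congr fun l => ?_) h
      simp [add_mul])
    (fun c K f => by
      ext k
      refine Eq.trans (tsum_congr fun l => ?_) (tsum_mul_left (a := c))
      simp [mul_assoc])
    (fun K f f' => by
      ext k
      have h := (summable_mul_of_memℓp (memℓp_row (lp.memℓp K) k) (lp.memℓp f)).tsum_add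
        (summable_mul_of_memℓp (memℓp_row (lp.memℓp K) k) (lp.memℓp f'))
      refine Eq.trans (tsum_congr fun l => ?_) h
      simp [mul_add])
    (fun c K f => by
      ext k
      refine Eq.trans (tsum_congr fun l => ?_) (tsum_mul_left (a := c))
      simp [mul_left_comm])

lemma kernelBilin_apply (K : lp (fun _ : ι × ι => ℂ) 2) (f : lp (fun _ : ι => ℂ) 2) (k : ι) :
    kernelBilin ι K f k = ∑' l, K (k, l) * f l := rfl

lemma norm_kernelBilin_le (K : lp (fun _ : ι × ι => ℂ) 2) (f : lp (fun _ : ι => ℂ) 2) :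
    ‖kernelBilin ι K f‖ ≤ 1 * ‖K‖ * ‖f‖ := by
  have h := tsum_enorm_rpow_two_kernel_le K f
  simp only [← kernelBilin_apply] at h
  rw [← lp_enorm_rpow_two, ← lp_enorm_rpow_two, ← lp_enorm_rpow_two,
    ← ENNReal.mul_rpow_of_nonneg _ _ (by norm_num), ENNReal.rpow_le_rpow_iff (by norm_num)] at h
  have h' := ENNReal.toReal_mono (ENNReal.mul_ne_top enorm_ne_top enorm_ne_top) h
  rw [one_mul]
  simpa using h'

/-- The operator with a square-summable kernel. -/
def kernelOperator (ι : Type*) : lp (fun _ : ι × ι => ℂ) 2 →L[ℂ]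
    lp (fun _ : ι => ℂ) 2 →L[ℂ] lp (fun _ : ι => ℂ) 2 :=
  (kernelBilin ι).mkContinuous₂ 1 norm_kernelBilin_le

lemma kernelOperator_apply (K : lp (fun _ : ι × ι => ℂ) 2) (f : lp (fun _ : ι => ℂ) 2) (k : ι) :
    kernelOperator ι K f k = ∑' l, K (k, l) * f l := rfl

/-- The operator depends continuously on its kernel, and a kernel in `ℓ²` is the sum of its single
entries. The operator is thus a norm limit of finite-rank, hence compact, operators. -/
lemma isCompactOperator_kernelOperator (K : lp (fun _ : ι × ι => ℂ) 2) :
    IsCompactOperator (kernelOperator ι K) := by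
  classical
  have hsum := (kernelOperator ι).hasSum (lp.hasSum_single (p := 2) (by simp) K)
  refine isCompactOperator_of_tendsto hsum (Eventually.of_forall fun s => ?_)
  refine Submodule.sum_mem (compactOperator (RingHom.id ℂ) (lp (fun _ : ι => ℂ) 2)
    (lp (fun _ : ι => ℂ) 2)) fun z _ => ?_
  change IsCompactOperator (kernelOperator ι (lp.single 2 z (K z)))
  obtain ⟨k, l⟩ := z
  -- A one-entry kernel factors through `ℂ`: evaluate at `l`, scale, then embed at `k`.
  have h1 : kernelOperator ι (lp.single 2 (k, l) (K (k, l))) =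
      (lp.singleContinuousLinearMap ℂ (fun _ : ι => ℂ) 2 k).comp
        (K (k, l) • lp.evalCLM ℂ (fun _ : ι => ℂ) 2 l) := by
    ext f k'
    rw [kernelOperator_apply, tsum_eq_single l]
    · by_cases hk : k' = k
      · subst hk
        simp only [lp.single_apply, Pi.single_eq_same, ContinuousLinearMap.comp_apply,
          lp.singleContinuousLinearMap_apply]
        rfl
      · simp [lp.single_apply, hk]
    · intro l' hl'
      simp [lp.single_apply, hl']
  rw [h1, ContinuousLinearMap.coe_comp]
  exact (isCompactOperator_of_locallyCompactSpace_dom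
    (K (k, l) • lp.evalCLM ℂ (fun _ : ι => ℂ) 2 l)).clm_comp _

end HilbertSchmidt

/-! ### Localization operators -/

section Localization

variable {n : ℕ}

/-- The matrix of the localization operator whose symbol has the Fourier coefficients `c`. -/
def localizationKernel (c : Lattice n × Lattice n → ℂ) (g₁ g₂ : Lattice n → ℂ)
    (z : Lattice n × Lattice n) : ℂ :=
  ∑' m, conj (g₁ (z.2 - m)) * (g₂ (z.1 - m) * c (m, z.2 - z.1))

lemma tsum_enorm_rpow_two_sub (g : Lattice n → ℂ) (l : Lattice n) :
    ∑' m, ‖g (l - m)‖ₑ ^ (2 : ℝ) = ∑' m, ‖g m‖ₑ ^ (2 : ℝ) :=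
  (Equiv.subLeft l).tsum_eq fun m => ‖g m‖ₑ ^ (2 : ℝ)

lemma enorm_conj (z : ℂ) : ‖conj z‖ₑ = ‖z‖ₑ := by
  rw [← ofReal_norm, RCLike.norm_conj, ofReal_norm]

lemma enorm_character (k : Lattice n) (w : Torus n) : ‖character k w‖ₑ = 1 := by
  rw [← ofReal_norm, norm_character, ENNReal.ofReal_one]

/-- Cauchy–Schwarz in `m` splits off `‖g₁‖²`. The remaining sum over `k`, `l`, `m` of `|g₂ (k - m)|²
|c (m, l - k)|²` decouples: sum first over `l`, then over `k`, using translation invariance each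
time. -/
lemma memℓp_localizationKernel {c : Lattice n × Lattice n → ℂ} {g₁ g₂ : Lattice n → ℂ}
    (hc : Memℓp c 2) (hg₁ : Memℓp g₁ 2) (hg₂ : Memℓp g₂ 2) :
    Memℓp (localizationKernel c g₁ g₂) 2 := by
  set A := ∑' m, ‖g₁ m‖ₑ ^ (2 : ℝ) with hA
  set B := ∑' m, ‖g₂ m‖ₑ ^ (2 : ℝ) with hB
  set C := ∑' z, ‖c z‖ₑ ^ (2 : ℝ) with hC
  have hABC : A * (C * B) ≠ ⊤ := ENNReal.mul_ne_top (tsum_enorm_rpow_two_ne_top hg₁)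
    (ENNReal.mul_ne_top (tsum_enorm_rpow_two_ne_top hc) (tsum_enorm_rpow_two_ne_top hg₂))
  refine memℓp_two_of_tsum_ne_top (ne_top_of_le_ne_top hABC ?_)
  have h1 : ∀ k l, ‖localizationKernel c g₁ g₂ (k, l)‖ₑ ^ (2 : ℝ) ≤
      A * ∑' m, ‖g₂ (k - m)‖ₑ ^ (2 : ℝ) * ‖c (m, l - k)‖ₑ ^ (2 : ℝ) := by
    intro k l
    refine (ENNReal.rpow_le_rpow (enorm_tsum_le_tsum_enorm (f := fun m =>
      conj (g₁ (l - m)) * (g₂ (k - m) * c (m, l - k)))) (by norm_num)).trans ?_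
    simp_rw [enorm_mul (conj _), enorm_conj]
    refine (tsum_mul_rpow_two_le _ _).trans_eq ?_
    rw [tsum_enorm_rpow_two_sub]
    simp_rw [enorm_mul, ENNReal.mul_rpow_of_nonneg _ _ (by norm_num : (0 : ℝ) ≤ 2)]
    rfl
  have h2 : ∀ k, ∑' l, ‖localizationKernel c g₁ g₂ (k, l)‖ₑ ^ (2 : ℝ) ≤
      A * ∑' m, ‖g₂ (k - m)‖ₑ ^ (2 : ℝ) * ∑' b, ‖c (m, b)‖ₑ ^ (2 : ℝ) := by
    intro k
    refine (ENNReal.tsum_le_tsum (h1 k)).trans_eq ?_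
    rw [ENNReal.tsum_mul_left, ENNReal.tsum_comm]
    congr 1
    refine tsum_congr fun m => ?_
    rw [ENNReal.tsum_mul_left]
    congr 1
    exact (Equiv.subRight k).tsum_eq fun b => ‖c (m, b)‖ₑ ^ (2 : ℝ)
  rw [ENNReal.tsum_prod (f := fun k l => ‖localizationKernel c g₁ g₂ (k, l)‖ₑ ^ (2 : ℝ))]
  refine (ENNReal.tsum_le_tsum h2).trans_eq ?_
  rw [ENNReal.tsum_mul_left, ENNReal.tsum_comm, hC,
    ENNReal.tsum_prod (f := fun a b => ‖c (a, b)‖ₑ ^ (2 : ℝ))]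
  congr 1
  rw [← ENNReal.tsum_mul_right]
  refine tsum_congr fun m => ?_
  rw [ENNReal.tsum_mul_right, mul_comm]
  congr 1
  exact (Equiv.subRight m).tsum_eq fun k => ‖g₂ k‖ₑ ^ (2 : ℝ)

lemma memℓp_translate {g : Lattice n → ℂ} (hg : Memℓp g 2) (m : Lattice n) :
    Memℓp (fun k => g (k - m)) 2 := by
  refine memℓp_two_of_tsum_ne_top ?_
  have h := (Equiv.subRight m).tsum_eq fun k => ‖g k‖ₑ ^ (2 : ℝ)
  exact h.trans_ne (tsum_enorm_rpow_two_ne_top hg)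

lemma summable_stftFun {f g : Lattice n → ℂ} (hf : Memℓp f 2) (hg : Memℓp g 2) (z : Phase n) :
    Summable fun k => f k * conj (character k z.2 * g (k - z.1)) := by
  refine summable_of_tsum_enorm_ne_top ?_
  simp_rw [enorm_mul, enorm_conj, enorm_mul, enorm_character, one_mul]
  exact tsum_enorm_mul_enorm_ne_top hf (memℓp_translate hg z.1)

lemma measurable_timeFreqShift (g : Lattice n → ℂ) (k : Lattice n) :
    Measurable fun z : Phase n => character k z.2 * g (k - z.1) :=
  measurable_from_prod_countable_right fun m =>
    (continuous_character k).measurable.mul_const (g (k - m))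

/-- Expand `V_{g₁} f` into its series and interchange it with the phase-space integral. The torus
integral of `σ (m, ·)` against `conj (character (l - k))` is `c (m, l - k)`, which produces the
matrix entry. -/
lemma isLocalizationOperator_kernelOperator {σ : Phase n → ℂ} {c : Lattice n × Lattice n → ℂ}
    {g₁ g₂ : Lattice n → ℂ} (hσ : Measurable σ) (hσ2 : MemLp σ 2 (phaseMeasure n))
    (hcσ : ∀ a b, torusCoeff (fun w => σ (a, w)) b = c (a, b))
    (hg₁ : Memℓp g₁ 2) (hg₂ : Memℓp g₂ 2)
    (hK : Memℓp (localizationKernel c g₁ g₂) 2) :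
    IsLocalizationOperator σ g₁ g₂
      (kernelOperator (Lattice n) ⟨localizationKernel c g₁ g₂, hK⟩) := by
  intro f
  have hf : Memℓp f 2 := lp.memℓp f
  refine ⟨summable_stftFun hf hg₁, fun k => ?_⟩
  set F : Lattice n → Phase n → ℂ := fun l z =>
    σ z * (f l * conj (character l z.2 * g₁ (l - z.1))) * (character k z.2 * g₂ (k - z.1)) with hF
  have hFm : ∀ l, Measurable (F l) := fun l =>
    (hσ.mul ((Complex.continuous_conj.measurable.comp
      (measurable_timeFreqShift g₁ l)).const_mul _)).mul (measurable_timeFreqShift g₂ k)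
  have hFe : ∀ l z, ‖F l z‖ₑ = ‖σ z‖ₑ * ‖g₂ (k - z.1)‖ₑ * (‖f l‖ₑ * ‖g₁ (l - z.1)‖ₑ) := by
    intro l z
    simp only [hF, enorm_mul, enorm_conj, enorm_character, one_mul]
    ring
  have hmg : Measurable fun z : Phase n => ‖g₂ (k - z.1)‖ₑ :=
    (measurable_of_countable fun m => ‖g₂ (k - m)‖ₑ).comp measurable_fst
  -- By translation invariance `S` bounds the series for `V_{g₁} f` absolutely and uniformly on
  -- phase space.
  set S := ∑' l, ‖f l‖ₑ ^ (2 : ℝ) + ∑' l, ‖g₁ l‖ₑ ^ (2 : ℝ)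
  have hS : S ≠ ⊤ := ENNReal.add_ne_top.2
    ⟨tsum_enorm_rpow_two_ne_top hf, tsum_enorm_rpow_two_ne_top hg₁⟩
  have hle : ∀ m, ∑' l, ‖f l‖ₑ * ‖g₁ (l - m)‖ₑ ≤ S := fun m => by
    refine (ENNReal.tsum_le_tsum fun l => mul_le_rpow_two_add_rpow_two _ _).trans_eq ?_
    rw [ENNReal.tsum_add]
    congr 1
    exact (Equiv.subRight m).tsum_eq fun l => ‖g₁ l‖ₑ ^ (2 : ℝ)
  -- Both factors are square integrable on phase space: the second is constant in the torus
  -- variable, and the torus has mass one.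
  have hσg : ∫⁻ z, ‖σ z‖ₑ * ‖g₂ (k - z.1)‖ₑ ∂phaseMeasure n ≠ ⊤ := by
    refine ne_top_of_le_ne_top ?_
      (lintegral_mono fun z => mul_le_rpow_two_add_rpow_two _ _)
    rw [lintegral_add_left (hσ.enorm.pow_const _), lintegral_phaseMeasure (hmg.pow_const _)]
    refine ENNReal.add_ne_top.2 ⟨lintegral_enorm_rpow_two_ne_top_of_memLp hσ2, ?_⟩
    simp only [lintegral_const, measure_univ, mul_one]
    rw [tsum_enorm_rpow_two_sub]
    exact tsum_enorm_rpow_two_ne_top hg₂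
  have hfin : ∑' l, ∫⁻ z, ‖F l z‖ₑ ∂phaseMeasure n ≠ ⊤ := by
    rw [← lintegral_tsum fun l => (hFm l).enorm.aemeasurable]
    refine ne_top_of_le_ne_top (ENNReal.mul_ne_top hσg hS) ?_
    rw [← lintegral_mul_const' _ _ hS]
    refine lintegral_mono fun z => ?_
    simp_rw [hFe]
    rw [ENNReal.tsum_mul_left]
    gcongr
    exact hle z.1
  obtain ⟨h1, h2⟩ := integrable_and_integral_eq_tsum_of_lintegral_ne_top hFm
    (fun z => (((summable_stftFun hf hg₁ z).hasSum.mul_left (σ z)).mul_right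
      (character k z.2 * g₂ (k - z.1)))) hfin
  refine ⟨h1, Eq.trans ?_ h2.symm⟩
  rw [kernelOperator_apply]
  refine tsum_congr fun l => ?_
  have hint : Integrable (F l) (phaseMeasure n) :=
    ⟨(hFm l).aestronglyMeasurable, (ENNReal.ne_top_of_tsum_ne_top hfin l).lt_top⟩
  rw [integral_phaseMeasure hint, mul_comm]
  change f l * localizationKernel c g₁ g₂ (k, l) = _
  rw [localizationKernel, ← tsum_mul_left]
  refine tsum_congr fun m => ?_
  rw [← hcσ, torusCoeff, ← integral_const_mul, ← integral_const_mul, ← integral_const_mul]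
  refine integral_congr_ae (ae_of_all _ fun w => ?_)
  simp only [hF, character_sub, map_mul, Complex.conj_conj]
  ring

end Localization

end DiscreteTF

end

/-! ### Compactness of localization operators -/

theorem mainTheorem2 (n : ℕ)
    (γ : DiscreteTF.SchwartzLattice n) (hγ : γ ≠ 0)
    (G : DiscreteTF.SchwartzPhase n) (hG : G ≠ 0)
    (Φ : ℝ≥0∞ → ℝ≥0∞) (hΦ : DiscreteTF.IsYoungFunction Φ)
    (hΦlog : ∀ x : ℝ, 0 ≤ x → x ≤ Real.exp (-(3 / 2)) →
      Φ (ENNReal.ofReal x) = ENNReal.ofReal (-(x ^ 2 * Real.log x)))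
    (p : ℝ≥0∞) (hp₁ : 1 ≤ p) (hp₂ : p ≤ 2)
    (U : DiscreteTF.TemperedPhase n) (hU : DiscreteTF.MemModulationPhase G p U)
    (g₁ g₂ : DiscreteTF.TemperedLattice n)
    (hg₁ : DiscreteTF.MemOrliczModulation γ Φ g₁)
    (hg₂ : DiscreteTF.MemOrliczModulation γ Φ g₂) :
    ∃ σ : DiscreteTF.Phase n → ℂ, DiscreteTF.TemperedPhase.IsFunction U σ ∧
      ∃ L : DiscreteTF.EllTwo n →L[ℂ] DiscreteTF.EllTwo n,
        DiscreteTF.IsLocalizationOperator σ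
          (DiscreteTF.TemperedLattice.toFun g₁) (DiscreteTF.TemperedLattice.toFun g₂) L ∧
        IsCompactOperator L := by
  have hc := hU.memℓp_two hG hp₁ hp₂
  -- The frequency is reflected because `U` pairs without conjugation: the Fourier coefficient of
  -- the symbol at `b` is the value of `U` on the monomial of frequency `-b`.
  have hc' : Memℓp (fun z : DiscreteTF.Lattice n × DiscreteTF.Lattice n =>
      U (DiscreteTF.SchwartzPhase.monomial (z.1, -z.2))) 2 := by
    have h := ((Equiv.refl (DiscreteTF.Lattice n)).prodCongr (Equiv.neg _)).tsum_eq
      fun z => ‖U (DiscreteTF.SchwartzPhase.monomial z)‖ₑ ^ (2 : ℝ)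
    exact DiscreteTF.memℓp_two_of_tsum_ne_top
      (h.trans_ne (DiscreteTF.tsum_enorm_rpow_two_ne_top hc))
  obtain ⟨σ, hσ, hσ2, hcσ⟩ := DiscreteTF.exists_symbol_torusCoeff_eq hc'
  have h₁ := hg₁.memℓp_two hγ hΦ hΦlog
  have h₂ := hg₂.memℓp_two hγ hΦ hΦlog
  exact ⟨σ, DiscreteTF.isFunction_of_torusCoeff_eq hσ hσ2 hcσ, _,
    DiscreteTF.isLocalizationOperator_kernelOperator hσ hσ2 hcσ h₁ h₂
      (DiscreteTF.memℓp_localizationKernel hc' h₁ h₂),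
    DiscreteTF.isCompactOperator_kernelOperator _⟩
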